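/- Let $M\ge 1$ and, for $m=1,\dots,M$, let $f_m(\cdot\,;0,1)$ be a probability density on $\mathbb{R}$ (with respect to Lebesgue measure); put $f_m(x;\mu,\sigma)=\frac1\sigma f_m\!\left(\frac{x-\mu}{\sigma};0,1\right)$ for $\mu\in\mathbb{R}$, $\sigma>0$. Let $$\Theta=\Big\{\theta=(\alpha_1,\mu_1,\sigma_1,\dots,\alpha_M,\mu_M,\sigma_M)\in\mathbb{R}^{3M} : \alpha_m\ge 0,\ \sum_{m=1}^M\alpha_m=1,\ \sigma_m>0\Big\}$$ with the Euclidean distance, and $f(x;\theta)=\sum_{m=1}^M\alpha_m f_m(x;\mu_m,\sigma_m)$. For $0\le K\le M$ let $\mathscr{G}_K$ be the set of all functions $\sum_{k\in\mathscr{K}}\alpha_k f_k(\cdot\,;\mu_k,\sigma_k)$ with $\mathscr{K}\subset\{1,\dots,M\}$, $|\mathscr{K}|\le K$ and $\theta\in\Theta$ (so $\mathscr{G}_0=\{0\}$). Let $\theta_0\in\Theta$ and $f_0=f(\cdot\,;\theta_0)$. Assume: 1. There are $v_0,v_1>0$ and $\beta>1$ with $f_m(x;0,1)\le\min\{v_0,\,v_1|x|^{-\beta}\}$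 for all $m$ and all $x$ (for $x=0$ the second bound is read as $+\infty$). 2. For each compact $\Gamma\subset\Theta$, each $\theta\in\Gamma$ and all sufficiently small $\rho>0$, the function $x\mapsto\sup\{f(x;\theta') : \theta'\in\Theta,\ \mathrm{dist}(\theta',\theta)\le\rho\}$ is (Lebesgue) measurable. 3. For each compact $\Gamma\subset\Theta$ and each $\theta\in\Gamma$ there is a Lebesgue null set $N$ such that for every sequence $\theta^{(j)}\in\Gamma$ with $\theta^{(j)}\to\theta$ and every $x\notin N$, $f(x;\theta^{(j)})\to f(x;\theta)$. 4. $\int|\log f(x;\theta_0)|\,f(x;\theta_0)\,dx<\infty$. 5. $f_0\in\mathscr{G}_M\setminus\mathscr{G}_{M-1}$. Let $c_0>0$, $0<d<1$, $c_n=c_0\exp(-n^d)$ and $\Theta_n=\{\theta\in\Theta : \sigma_m\ge c_n,\ m=1,\dots,M\}$. Let $x_1,x_2,\dots$ be independent real random variables on a probability space, each with density $f_0$, and let $\hat\theta_n$ be a maximum likelihood estimator restricted to $\Theta_n$: almost surely, for all sufficiently large $n$, $\hat\theta_n$ is a maximizer of $\theta\mapsto\prod_{i=1}^n f(x_i;\theta)$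 over $\Theta_n$. Then the estimated density $\hat f_n=f(\cdot\,;\hat\theta_n)$ is strongly consistent: $$\lim_{n\to\infty}\|\hat f_n-f_0\|_{L^1(\mathbb{R})}=0\quad\text{almost surely}.$$ -/

import Mathlib

open MeasureTheory ProbabilityTheory Filter Topology

noncomputable section

namespace LocScaleMixture

/-- Parameter vectors `(α₁, μ₁, σ₁, …, α_M, μ_M, σ_M) ∈ ℝ^{3M}`, with the Euclidean distance. -/
abbrev Param (M : ℕ) : Type := EuclideanSpace ℝ (Fin M × Fin 3)

/-- Mixing weight `α_m`. -/
def Param.weight {M : ℕ} (θ : Param M) (m : Fin M) : ℝ := θ (m, 0)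

/-- Location parameter `μ_m`. -/
def Param.loc {M : ℕ} (θ : Param M) (m : Fin M) : ℝ := θ (m, 1)

/-- Scale parameter `σ_m`. -/
def Param.scale {M : ℕ} (θ : Param M) (m : Fin M) : ℝ := θ (m, 2)

/-- The parameter space `Θ`. -/
def paramSpace (M : ℕ) : Set (Param M) :=
  {θ | (∑ m, θ.weight m = 1) ∧ (∀ m, 0 ≤ θ.weight m) ∧ ∀ m, 0 < θ.scale m}

/-- `φ` is a probability density on `ℝ` with respect to Lebesgue measure.
(`AEMeasurable` with respect to `volume` is Lebesgue measurability.) -/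
def IsDensity (φ : ℝ → ℝ) : Prop :=
  AEMeasurable φ volume ∧ (∀ x, 0 ≤ φ x) ∧ ∫⁻ x, ENNReal.ofReal (φ x) = 1

/-- The member with location `μ` and scale `σ` of the location-scale family generated by the
standard density `φ`. -/
def locScale (φ : ℝ → ℝ) (μ σ x : ℝ) : ℝ := (1 / σ) * φ ((x - μ) / σ)

/-- `f_𝒦(x; θ_𝒦) = ∑_{k ∈ 𝒦} α_k f_k(x; μ_k, σ_k)`; here `f m` is the standard density
`f_m(·; 0, 1)` of the `m`-th family. -/
def subMixture {M : ℕ} (f : Fin M → ℝ → ℝ) (K : Finset (Fin M)) (θ : Param M) (x : ℝ) : ℝ :=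
  ∑ k ∈ K, θ.weight k * locScale (f k) (θ.loc k) (θ.scale k) x

/-- The mixture density `f(x; θ)`. -/
def mixture {M : ℕ} (f : Fin M → ℝ → ℝ) (θ : Param M) (x : ℝ) : ℝ :=
  ∑ m, θ.weight m * locScale (f m) (θ.loc m) (θ.scale m) x

/-- `𝒢_𝒦`: the subprobability densities built from the components in `𝒦`. -/
def subDensities {M : ℕ} (f : Fin M → ℝ → ℝ) (K : Finset (Fin M)) : Set (ℝ → ℝ) :=
  {g | ∃ θ ∈ paramSpace M, ∑ k ∈ K, θ.weight k ≤ 1 ∧ g = subMixture f K θ}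

/-- `𝒢_k`: the subprobability densities with no more than `k` components. -/
def subDensitiesCard {M : ℕ} (f : Fin M → ℝ → ℝ) (k : ℕ) : Set (ℝ → ℝ) :=
  ⋃ (K : Finset (Fin M)) (_ : K.card ≤ k), subDensities f K

/-- The standard component densities are bounded, with tails of order at most `|x|^{-β}`,
for some `β > 1`. (At `x = 0` the tail bound is `+∞`, hence no condition.) -/
def TailBound {M : ℕ} (f : Fin M → ℝ → ℝ) : Prop :=
  ∃ v₀ v₁ β : ℝ, 0 < v₀ ∧ 0 < v₁ ∧ 1 < β ∧
    ∀ m x, f m x ≤ v₀ ∧ (x ≠ 0 → f m x ≤ v₁ * |x| ^ (-β))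

/-- `f(x; θ, ρ)`: the supremum of `f(x; θ')` over `θ' ∈ Θ` with `dist(θ', θ) ≤ ρ`. -/
def mixtureSup {M : ℕ} (f : Fin M → ℝ → ℝ) (θ : Param M) (ρ x : ℝ) : ℝ :=
  sSup ((fun θ' => mixture f θ' x) '' {θ' | θ' ∈ paramSpace M ∧ dist θ' θ ≤ ρ})

/-- For each `θ` in a compact subset of `Θ` and all sufficiently small `ρ > 0`, the function
`f(·; θ, ρ)` is (Lebesgue) measurable. -/
def LocalSupMeasurable {M : ℕ} (f : Fin M → ℝ → ℝ) : Prop :=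
  ∀ Γ : Set (Param M), IsCompact Γ → Γ ⊆ paramSpace M → ∀ θ ∈ Γ,
    ∀ᶠ ρ in 𝓝[>] (0 : ℝ), AEMeasurable (mixtureSup f θ ρ) volume

/-- On compact subsets of `Θ`, the density is sequentially continuous in the parameter off a
Lebesgue null set that does not depend on the sequence. -/
def ContinuousInParam {M : ℕ} (f : Fin M → ℝ → ℝ) : Prop :=
  ∀ Γ : Set (Param M), IsCompact Γ → Γ ⊆ paramSpace M → ∀ θ ∈ Γ,
    ∃ N : Set ℝ, volume N = 0 ∧
      ∀ θs : ℕ → Param M, (∀ j, θs j ∈ Γ) → Tendsto θs atTop (𝓝 θ) →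
        ∀ x, x ∉ N → Tendsto (fun j => mixture f (θs j) x) atTop (𝓝 (mixture f θ x))

/-- `∫ |log f(x; θ₀)| f(x; θ₀) dx < ∞`. -/
def FiniteEntropy {M : ℕ} (f : Fin M → ℝ → ℝ) (θ₀ : Param M) : Prop :=
  Integrable (fun x => |Real.log (mixture f θ₀ x)| * mixture f θ₀ x) volume

/-- The distribution on `ℝ` with density `f(·; θ)`. -/
def mixtureMeasure {M : ℕ} (f : Fin M → ℝ → ℝ) (θ : Param M) : Measure ℝ :=
  volume.withDensity fun x => ENNReal.ofReal (mixture f θ x)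

/-- The restricted parameter space of all `θ ∈ Θ` with `σ_m ≥ c` for every `m`. -/
def sieve (M : ℕ) (c : ℝ) : Set (Param M) :=
  {θ | θ ∈ paramSpace M ∧ ∀ m, c ≤ θ.scale m}

/-- The likelihood of the first `n` observations `x 0, …, x (n - 1)`. -/
def likelihood {M : ℕ} (f : Fin M → ℝ → ℝ) (x : ℕ → ℝ) (n : ℕ) (θ : Param M) : ℝ :=
  ∏ i ∈ Finset.range n, mixture f θ (x i)

/-- `θ` is a maximum likelihood estimate restricted to `S`, from the first `n` observations. -/
def IsMLE {M : ℕ} (f : Fin M → ℝ → ℝ) (S : Set (Param M)) (x : ℕ → ℝ) (n : ℕ)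
    (θ : Param M) : Prop :=
  θ ∈ S ∧ ∀ θ' ∈ S, likelihood f x n θ' ≤ likelihood f x n θ

end LocScaleMixture

end

/-!
If a density `g` is at total variation distance at least `δ` from the true density `F`, then its
Hellinger affinity `∫ √(g F)` is at most `1 - δ² / 2`, so by Markov's inequality applied to the
square root of the likelihood ratio, `g` attains the likelihood of `F` on a sample of size `n` with
probability at most `(1 - δ² / 2) ^ n`. Replacing `g` by an upper bracket of excess `η` increases
the affinity by at most `√η`. Hence, if a class of densities is covered by `N` upper brackets of
small enough excess, some `g` in it at distance at least `δ` from `F` attains the likelihood of `F`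
with probability at most `N * exp (-τ n)` for some `τ > 0`.

Almost surely, the sample of size `n` eventually lies in `[-A, A]` with `A = exp (n ^ d)`. There a
component whose location or scale exceeds a large multiple of `A` is at most a small multiple of
`1 / A`, so a single bracket serves all of them. Every other component is an affine image of one
whose location and scale are close to `0` and `1`, where the supremum of the density over a small
parameter ball is a bracket. As the scales are bounded below by a multiple of `1 / A`, the number of
brackets is polynomial in `A`, hence `exp (O (n ^ d))`. This times `exp (-τ n)` is summable because
`d < 1`, and Borel–Cantelli shows that the maximizer is eventually within `δ` of `F`.
-/

noncomputable section

namespace LocScaleMixture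

open scoped ENNReal

section Affinity

variable {α : Type*} [MeasurableSpace α] {μ : Measure α} {u v w : α → ℝ≥0∞}

/-- The Hellinger affinity `∫ √(u v) dμ` of two nonnegative functions. -/
def affinity (μ : Measure α) (u v : α → ℝ≥0∞) : ℝ≥0∞ := ∫⁻ x, (u x * v x) ^ (1 / 2 : ℝ) ∂μ

lemma affinity_le_mul (hu : AEMeasurable u μ) (hv : AEMeasurable v μ) :
    affinity μ u v ≤ (∫⁻ x, u x ∂μ) ^ (1 / 2 : ℝ) * (∫⁻ x, v x ∂μ) ^ (1 / 2 : ℝ) := by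
  have h := ENNReal.lintegral_mul_norm_pow_le hu hv (p := 1 / 2) (q := 1 / 2)
    (by norm_num) (by norm_num) (by norm_num)
  simpa only [affinity, ENNReal.mul_rpow_of_nonneg _ _ (by norm_num : (0 : ℝ) ≤ 1 / 2)] using h

lemma affinity_le_add_affinity_sub (hw : AEMeasurable w μ) (hv : AEMeasurable v μ) :
    affinity μ u v ≤ affinity μ w v + affinity μ (u - w) v := by
  rw [affinity, affinity, affinity, ← lintegral_add_left' ((hw.fun_mul hv).pow_const _)]
  refine lintegral_mono fun x => ?_
  calc (u x * v x) ^ (1 / 2 : ℝ) ≤ (w x * v x + (u x - w x) * v x) ^ (1 / 2 : ℝ) := by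
        rw [← add_mul]
        gcongr
        exact le_add_tsub
    _ ≤ (w x * v x) ^ (1 / 2 : ℝ) + ((u x - w x) * v x) ^ (1 / 2 : ℝ) :=
        ENNReal.rpow_add_le_add_rpow _ _ (by norm_num) (by norm_num)

lemma affinity_le_of_le_lintegral_sub (hu : AEMeasurable u μ) (hv : AEMeasurable v μ)
    (hu1 : ∫⁻ x, u x ∂μ = 1) (hv1 : ∫⁻ x, v x ∂μ = 1) {δ : ℝ} (hδ : 0 ≤ δ)
    (h : ENNReal.ofReal δ ≤ ∫⁻ x, (u x - v x) ∂μ) :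
    affinity μ u v ≤ ENNReal.ofReal (1 - δ ^ 2 / 2) := by
  -- Cauchy–Schwarz for `u v = min u v * max u v`, whose factors have integrals `1 - t` and `1 + t`.
  obtain ⟨t, ht⟩ : ∃ t, t = ∫⁻ x, (u x - v x) ∂μ := ⟨_, rfl⟩
  rw [← ht] at h
  have hmin : t + ∫⁻ x, min (u x) (v x) ∂μ = 1 := by
    rw [ht, ← lintegral_add_left' (hu.fun_sub hv), ← hu1]
    exact lintegral_congr fun x => tsub_add_min
  have hmax : ∫⁻ x, max (u x) (v x) ∂μ = 1 + t := by
    rw [ht, ← hv1, ← lintegral_add_left' hv]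
    exact lintegral_congr fun x => by rw [add_tsub_eq_max, max_comm]
  have ht1 : t ≤ 1 := le_of_le_of_eq le_self_add hmin
  have htop : t ≠ ⊤ := ne_top_of_le_ne_top ENNReal.one_ne_top ht1
  have hprod : affinity μ u v ≤ (1 - t) ^ (1 / 2 : ℝ) * (1 + t) ^ (1 / 2 : ℝ) := by
    calc affinity μ u v = affinity μ (fun x => min (u x) (v x)) (fun x => max (u x) (v x)) := by
          simp only [affinity, min_mul_max]
      _ ≤ _ := affinity_le_mul (hu.min hv) (hu.max hv)
      _ = _ := by
          rw [hmax, ENNReal.eq_sub_of_add_eq' ENNReal.one_ne_top ((add_comm _ _).trans hmin)]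
  lift t to NNReal using htop
  have ht1' : (t : ℝ) ≤ 1 := by exact_mod_cast ht1
  have hδt : δ ≤ t := by simpa using (ENNReal.ofReal_le_iff_le_toReal ENNReal.coe_ne_top).1 h
  calc affinity μ u v ≤ (ENNReal.ofReal ((1 - t) * (1 + t))) ^ (1 / 2 : ℝ) := by
        rwa [ENNReal.ofReal_mul (by linarith), ENNReal.mul_rpow_of_nonneg _ _ (by norm_num),
          ENNReal.ofReal_sub _ t.coe_nonneg, ENNReal.ofReal_add zero_le_one t.coe_nonneg,
          ENNReal.ofReal_one, ENNReal.ofReal_coe_nnreal]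
    _ = ENNReal.ofReal √((1 - t) * (1 + t)) := by
        rw [ENNReal.ofReal_rpow_of_nonneg (by nlinarith [t.coe_nonneg]) (by norm_num),
          Real.sqrt_eq_rpow]
    _ ≤ ENNReal.ofReal (1 - δ ^ 2 / 2) := by
        refine ENNReal.ofReal_le_ofReal (Real.sqrt_le_iff.2 ⟨?_, ?_⟩) <;>
          nlinarith [sq_nonneg (δ ^ 2)]

lemma lintegral_sub_eq_lintegral_sub_swap (hu : AEMeasurable u μ) (hv : AEMeasurable v μ)
    (huv : ∫⁻ x, u x ∂μ = ∫⁻ x, v x ∂μ) (hv_fin : ∫⁻ x, v x ∂μ ≠ ⊤) :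
    ∫⁻ x, (u x - v x) ∂μ = ∫⁻ x, (v x - u x) ∂μ := by
  have hmin_ne_top : ∫⁻ x, min (u x) (v x) ∂μ ≠ ⊤ :=
    ne_top_of_le_ne_top hv_fin (lintegral_mono fun x => min_le_right _ _)
  refine (ENNReal.add_left_inj hmin_ne_top).1 ?_
  rw [← lintegral_add_left' (hu.fun_sub hv), ← lintegral_add_left' (hv.fun_sub hu)]
  calc ∫⁻ x, (u x - v x + min (u x) (v x)) ∂μ = ∫⁻ x, u x ∂μ := by simp only [tsub_add_min]
    _ = ∫⁻ x, v x ∂μ := huv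
    _ = ∫⁻ x, (v x - u x + min (u x) (v x)) ∂μ := by
      refine lintegral_congr fun x => ?_
      rw [min_comm, tsub_add_min]

lemma eLpNorm_sub_one_eq_two_mul_lintegral {p q : α → ℝ} (hp : AEMeasurable p μ)
    (hq : AEMeasurable q μ) (hp0 : ∀ x, 0 ≤ p x) (hq0 : ∀ x, 0 ≤ q x)
    (hpq : ∫⁻ x, ENNReal.ofReal (p x) ∂μ = ∫⁻ x, ENNReal.ofReal (q x) ∂μ)
    (hq_fin : ∫⁻ x, ENNReal.ofReal (q x) ∂μ ≠ ⊤) :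
    eLpNorm (fun x => p x - q x) 1 μ
      = 2 * ∫⁻ x, (ENNReal.ofReal (p x) - ENNReal.ofReal (q x)) ∂μ := by
  have habs (x : α) : ‖p x - q x‖ₑ = (ENNReal.ofReal (p x) - ENNReal.ofReal (q x))
      + (ENNReal.ofReal (q x) - ENNReal.ofReal (p x)) := by
    rw [← ENNReal.ofReal_sub _ (hq0 x), ← ENNReal.ofReal_sub _ (hp0 x), Real.enorm_eq_ofReal_abs]
    rcases le_total (p x) (q x) with h | h
    · rw [abs_of_nonpos (by linarith), ENNReal.ofReal_of_nonpos (by linarith : p x - q x ≤ 0),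
        zero_add, neg_sub]
    · rw [abs_of_nonneg (by linarith), ENNReal.ofReal_of_nonpos (by linarith : q x - p x ≤ 0),
        add_zero]
  simp only [eLpNorm_one_eq_lintegral_enorm, habs]
  rw [lintegral_add_left' (hp.ennreal_ofReal.fun_sub hq.ennreal_ofReal), two_mul,
    lintegral_sub_eq_lintegral_sub_swap hp.ennreal_ofReal hq.ennreal_ofReal hpq hq_fin]

end Affinity

section Brackets

variable {α : Type*} [MeasurableSpace α] {μ : Measure α} {s s' : Set α} {η η' : ℝ≥0∞}
  {g u F : α → ℝ≥0∞}

/-- `u` is an upper bracket of `g` over `s`, with excess at most `η`. Domination is asked on `s`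
only, because a likelihood sees `g` at the sample points only; the excess is integrated over the
whole space. -/
structure IsUpperBracket (μ : Measure α) (s : Set α) (η : ℝ≥0∞) (g u : α → ℝ≥0∞) : Prop where
  aemeasurable : AEMeasurable u μ
  le_on : ∀ x ∈ s, g x ≤ u x
  excess_le : ∫⁻ x, (u x - g x) ∂μ ≤ η

/-- The one-sided bracketing number of the class `G` is at most `N`: every member of `G` has an
upper bracket in a common set of at most `N` functions. -/
def HasUpperBrackets (μ : Measure α) (s : Set α) (η : ℝ≥0∞) (N : ℝ) (G : Set (α → ℝ≥0∞)) :
    Prop :=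
  ∃ 𝒰 : Finset (α → ℝ≥0∞), (𝒰.card : ℝ) ≤ N ∧ ∀ g ∈ G, ∃ u ∈ 𝒰, IsUpperBracket μ s η g u

lemma IsUpperBracket.mono (h : IsUpperBracket μ s η g u) (hs : s' ⊆ s) (hη : η ≤ η') :
    IsUpperBracket μ s' η' g u :=
  ⟨h.aemeasurable, fun x hx => h.le_on x (hs hx), h.excess_le.trans hη⟩

lemma HasUpperBrackets.mono {G G' : Set (α → ℝ≥0∞)} {N N' : ℝ} (h : HasUpperBrackets μ s η N G)
    (hη : η ≤ η') (hN : N ≤ N') (hG : G' ⊆ G) : HasUpperBrackets μ s η' N' G' := by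
  obtain ⟨𝒰, hcard, hbr⟩ := h
  refine ⟨𝒰, hcard.trans hN, fun g hg => ?_⟩
  obtain ⟨u, hu, hgu⟩ := hbr g (hG hg)
  exact ⟨u, hu, hgu.mono subset_rfl hη⟩

lemma IsUpperBracket.affinity_le (h : IsUpperBracket μ s η g u) (hg : AEMeasurable g μ)
    (hF : AEMeasurable F μ) :
    affinity μ u F
      ≤ affinity μ g F + η ^ (1 / 2 : ℝ) * (∫⁻ x, F x ∂μ) ^ (1 / 2 : ℝ) := by
  refine (affinity_le_add_affinity_sub hg hF).trans ?_
  gcongr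
  refine (affinity_le_mul (h.aemeasurable.sub hg) hF).trans ?_
  gcongr
  exact h.excess_le

lemma IsUpperBracket.const_mul {a w : ℝ≥0∞} (h : IsUpperBracket μ s η g u)
    (hg : AEMeasurable g μ) (hg1 : ∫⁻ x, g x ∂μ ≤ 1) (hη : η ≤ 1) (hw : w ≤ 1) (hwa : w ≤ a)
    (haw : a ≤ w + η) :
    IsUpperBracket μ s (3 * η) (fun x => w * g x) (fun x => a * u x) := by
  refine ⟨h.aemeasurable.const_mul a, fun x hx => mul_le_mul' hwa (h.le_on x hx), ?_⟩
  have hexcess (x : α) : a * u x - w * g x ≤ a * (u x - g x) + (a - w) * g x := by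
    rw [tsub_le_iff_right, add_assoc, ← add_mul, tsub_add_cancel_of_le hwa, ← mul_add]
    gcongr
    exact le_tsub_add
  calc ∫⁻ x, (a * u x - w * g x) ∂μ
      ≤ ∫⁻ x, (a * (u x - g x) + (a - w) * g x) ∂μ := lintegral_mono hexcess
    _ = a * ∫⁻ x, (u x - g x) ∂μ + (a - w) * ∫⁻ x, g x ∂μ := by
        rw [lintegral_add_right' _ (hg.const_mul _), lintegral_const_mul'' _ hg,
          lintegral_const_mul'' _ (h.aemeasurable.fun_sub hg)]
    _ ≤ 2 * η + η * 1 := by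
        gcongr
        · exact haw.trans ((add_le_add hw hη).trans_eq one_add_one_eq_two)
        · exact h.excess_le
        · exact tsub_le_iff_left.2 haw
    _ = 3 * η := by ring

lemma IsUpperBracket.sum {ι : Type*} {t : Finset ι} {ε : ι → ℝ≥0∞} {g u : ι → α → ℝ≥0∞}
    (h : ∀ i ∈ t, IsUpperBracket μ s (ε i) (g i) (u i)) (hg : ∀ i ∈ t, AEMeasurable (g i) μ) :
    IsUpperBracket μ s (∑ i ∈ t, ε i) (fun x => ∑ i ∈ t, g i x) (fun x => ∑ i ∈ t, u i x) := by
  refine ⟨Finset.aemeasurable_fun_sum t fun i hi => (h i hi).aemeasurable,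
    fun x hx => Finset.sum_le_sum fun i hi => (h i hi).le_on x hx, ?_⟩
  calc ∫⁻ x, (∑ i ∈ t, u i x - ∑ i ∈ t, g i x) ∂μ
      ≤ ∫⁻ x, ∑ i ∈ t, (u i x - g i x) ∂μ := by
        refine lintegral_mono fun x => tsub_le_iff_right.2 ?_
        rw [← Finset.sum_add_distrib]
        exact Finset.sum_le_sum fun i _ => le_tsub_add
    _ = ∑ i ∈ t, ∫⁻ x, (u i x - g i x) ∂μ :=
        lintegral_finsetSum' _ fun i hi => (h i hi).aemeasurable.fun_sub (hg i hi)
    _ ≤ ∑ i ∈ t, ε i := Finset.sum_le_sum fun i hi => (h i hi).excess_le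

lemma exists_natCast_mul_mem_Icc {x r R : ℝ} (hr : 0 < r) (hx : 0 ≤ x) (hxR : x ≤ R) :
    ∃ i ∈ Finset.range (⌈R / r⌉₊ + 1), (i : ℝ) * r ∈ Set.Icc x (x + r) := by
  refine ⟨⌈x / r⌉₊, ?_, ?_, ?_⟩
  · rw [Finset.mem_range, Nat.lt_succ_iff]
    gcongr
  · exact (div_le_iff₀ hr).1 (Nat.le_ceil _)
  · have h := (Nat.ceil_lt_add_one (div_nonneg hx hr.le)).le
    calc (⌈x / r⌉₊ : ℝ) * r ≤ (x / r + 1) * r := by gcongr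
      _ = x + r := by rw [add_mul, div_mul_cancel₀ _ hr.ne', one_mul]

variable {ι : Type*} [Fintype ι] {G : ι → Set (α → ℝ≥0∞)} {N : ι → ℝ}

/-- The mixtures `∑ i, w i * g i` with one component `g i` from each class `G i` and weights `w`
in the probability simplex. -/
def mixtures (G : ι → Set (α → ℝ≥0∞)) : Set (α → ℝ≥0∞) :=
  {h | ∃ w ∈ stdSimplex ℝ ι, ∃ g : ι → α → ℝ≥0∞, (∀ i, g i ∈ G i) ∧
    h = fun x => ∑ i, ENNReal.ofReal (w i) * g i x}

lemma hasUpperBrackets_mixtures {ε : ℝ} (hε : 0 < ε) (hε1 : ε ≤ 1)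
    (hmeas : ∀ i, ∀ g ∈ G i, AEMeasurable g μ) (hint : ∀ i, ∀ g ∈ G i, ∫⁻ x, g x ∂μ ≤ 1)
    (h : ∀ i, HasUpperBrackets μ s (ENNReal.ofReal ε) (N i) (G i)) :
    HasUpperBrackets μ s (Fintype.card ι * (3 * ENNReal.ofReal ε))
      (∏ i, (⌈1 / ε⌉₊ + 1) * N i) (mixtures G) := by
  -- Round the weights up to multiples of `ε`, and the components up to their brackets.
  classical
  choose 𝒰 hcard hbr using h
  refine ⟨(Fintype.piFinset fun i => Finset.range (⌈1 / ε⌉₊ + 1) ×ˢ 𝒰 i).image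
    fun p x => ∑ i, ENNReal.ofReal ((p i).1 * ε) * (p i).2 x, ?_, ?_⟩
  · refine (Nat.cast_le.2 Finset.card_image_le).trans ?_
    rw [Fintype.card_piFinset, Nat.cast_prod]
    refine Finset.prod_le_prod (fun i _ => Nat.cast_nonneg _) fun i _ => ?_
    rw [Finset.card_product, Finset.card_range]
    push_cast
    gcongr
    exact hcard i
  · rintro _ ⟨w, hw, g, hg, rfl⟩
    have hw01 (i : ι) : w i ∈ Set.Icc (0 : ℝ) 1 := mem_Icc_of_mem_stdSimplex hw i
    choose u hu hgu using fun i => hbr i (g i) (hg i)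
    choose k hk hwk using fun i => exists_natCast_mul_mem_Icc hε (hw01 i).1 (hw01 i).2
    refine ⟨_, Finset.mem_image_of_mem _ (Fintype.mem_piFinset (f := fun i => (k i, u i)).2
      fun i => Finset.mem_product.2 ⟨hk i, hu i⟩), ?_⟩
    have hsum := IsUpperBracket.sum (t := Finset.univ)
      (fun i _ => (hgu i).const_mul (hmeas i _ (hg i)) (hint i _ (hg i))
        (ENNReal.ofReal_le_one.2 hε1) (ENNReal.ofReal_le_one.2 (hw01 i).2)
        (ENNReal.ofReal_le_ofReal (hwk i).1)
        ((ENNReal.ofReal_le_ofReal (hwk i).2).trans ENNReal.ofReal_add_le))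
      (fun i _ => (hmeas i _ (hg i)).const_mul _)
    simpa only [Finset.sum_const, Finset.card_univ, nsmul_eq_mul] using hsum

end Brackets

section LargeDeviations

variable {α Ω ι : Type*} [MeasurableSpace α] [MeasurableSpace Ω] {μ ν : Measure α}
  {P : Measure Ω} {X : ι → Ω → α} {u F : α → ℝ≥0∞}

lemma measure_one_le_prod_le (hX : ∀ i, Measurable (X i)) (hindep : iIndepFun X P)
    (hlaw : ∀ i, P.map (X i) = ν) (hu : AEMeasurable u ν) (s : Finset ι) :
    P {ω | 1 ≤ ∏ i ∈ s, u (X i ω)} ≤ (∫⁻ x, u x ∂ν) ^ s.card := by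
  have hmk (i : ι) : ∀ᵐ ω ∂P, u (X i ω) = hu.mk u (X i ω) :=
    ae_of_ae_map (hX i).aemeasurable (by rw [hlaw i]; exact hu.ae_eq_mk)
  have hmkX (i : ι) : Measurable fun ω => hu.mk u (X i ω) := hu.measurable_mk.comp (hX i)
  calc P {ω | 1 ≤ ∏ i ∈ s, u (X i ω)} ≤ P {ω | 1 ≤ ∏ i ∈ s, hu.mk u (X i ω)} := by
        refine measure_mono_ae ?_
        filter_upwards [(ae_ball_iff s.countable_toSet).2 fun i _ => hmk i] with ω hω
        exact fun h => h.trans_eq (Finset.prod_congr rfl hω)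
    _ ≤ ∫⁻ ω, ∏ i ∈ s, hu.mk u (X i ω) ∂P := by
        simpa only [one_mul] using mul_meas_ge_le_lintegral
          (μ := P) (Finset.measurable_fun_prod s fun i _ => hmkX i) 1
    _ = ∏ i ∈ s, ∫⁻ ω, hu.mk u (X i ω) ∂P :=
        lintegral_prod_eq_prod_lintegral_of_indepFun s _
          (hindep.comp _ fun _ => hu.measurable_mk) hmkX
    _ = (∫⁻ x, u x ∂ν) ^ s.card := by
        refine Finset.prod_eq_pow_card fun i _ => ?_
        rw [← lintegral_map hu.measurable_mk (hX i), hlaw i, lintegral_congr_ae hu.ae_eq_mk]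

lemma mul_div_rpow_half_le (a b : ℝ≥0∞) :
    b * (a / b) ^ (1 / 2 : ℝ) ≤ (a * b) ^ (1 / 2 : ℝ) := by
  rcases eq_or_ne b 0 with rfl | hb0
  · simp
  rcases eq_or_ne b ⊤ with rfl | hbtop
  · simp [ENNReal.div_top]
  refine le_of_eq ?_
  calc b * (a / b) ^ (1 / 2 : ℝ) = (b ^ (2 : ℝ) * (a / b)) ^ (1 / 2 : ℝ) := by
        rw [ENNReal.mul_rpow_of_nonneg _ _ (by norm_num), ← ENNReal.rpow_mul]
        norm_num
    _ = (a * b) ^ (1 / 2 : ℝ) := by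
        rw [ENNReal.rpow_two, sq, mul_assoc, ENNReal.mul_div_cancel hb0 hbtop, mul_comm]

lemma lintegral_div_rpow_half_withDensity_le (hu : AEMeasurable u μ) (hF : AEMeasurable F μ) :
    ∫⁻ x, (u x / F x) ^ (1 / 2 : ℝ) ∂(μ.withDensity F) ≤ affinity μ u F := by
  rw [lintegral_withDensity_eq_lintegral_mul₀ hF ((hu.fun_div hF).pow_const _)]
  exact lintegral_mono fun x => mul_div_rpow_half_le _ _

lemma one_le_prod_div_rpow_half {s : Finset ι} {a b : ι → ℝ≥0∞}
    (hb : ∀ i ∈ s, b i ≠ 0 ∧ b i ≠ ⊤) (h : ∏ i ∈ s, b i ≤ ∏ i ∈ s, a i) :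
    1 ≤ ∏ i ∈ s, (a i / b i) ^ (1 / 2 : ℝ) := by
  rw [ENNReal.prod_rpow_of_nonneg (by norm_num)]
  refine ENNReal.one_le_rpow ?_ (by norm_num)
  have hb0 : ∏ i ∈ s, b i ≠ 0 := Finset.prod_ne_zero_iff.2 fun i hi => (hb i hi).1
  have hbtop : ∏ i ∈ s, b i ≠ ⊤ := ENNReal.prod_ne_top fun i hi => (hb i hi).2
  refine (ENNReal.mul_le_mul_iff_right hb0 hbtop).1 ?_
  rw [mul_one, ← Finset.prod_mul_distrib]
  refine h.trans_eq (Finset.prod_congr rfl fun i hi => ?_)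
  rw [ENNReal.mul_div_cancel (hb i hi).1 (hb i hi).2]

lemma ae_withDensity_ne_zero_and_ne_top (hF : AEMeasurable F μ) (hF_fin : ∫⁻ x, F x ∂μ ≠ ⊤) :
    ∀ᵐ x ∂(μ.withDensity F), F x ≠ 0 ∧ F x ≠ ⊤ := by
  rw [ae_withDensity_iff' hF]
  filter_upwards [ae_lt_top' hF hF_fin] with x hx hx0
  exact ⟨hx0, hx.ne⟩

lemma measure_prod_le_prod_le (hX : ∀ i, Measurable (X i)) (hindep : iIndepFun X P)
    (hlaw : ∀ i, P.map (X i) = μ.withDensity F) (hF : AEMeasurable F μ)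
    (hF_fin : ∫⁻ x, F x ∂μ ≠ ⊤) (hu : AEMeasurable u μ) (s : Finset ι) :
    P {ω | ∏ i ∈ s, F (X i ω) ≤ ∏ i ∈ s, u (X i ω)} ≤ affinity μ u F ^ s.card := by
  have hF_pos (i : ι) : ∀ᵐ ω ∂P, F (X i ω) ≠ 0 ∧ F (X i ω) ≠ ⊤ :=
    ae_of_ae_map (hX i).aemeasurable
      (by rw [hlaw i]; exact ae_withDensity_ne_zero_and_ne_top hF hF_fin)
  calc P {ω | ∏ i ∈ s, F (X i ω) ≤ ∏ i ∈ s, u (X i ω)}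
      ≤ P {ω | 1 ≤ ∏ i ∈ s, (u (X i ω) / F (X i ω)) ^ (1 / 2 : ℝ)} := by
        refine measure_mono_ae ?_
        filter_upwards [(ae_ball_iff s.countable_toSet).2 fun i _ => hF_pos i] with ω hω
        exact one_le_prod_div_rpow_half hω
    _ ≤ (∫⁻ x, (u x / F x) ^ (1 / 2 : ℝ) ∂(μ.withDensity F)) ^ s.card :=
        measure_one_le_prod_le hX hindep hlaw
          (((hu.div hF).pow_const _).mono_ac (withDensity_absolutelyContinuous _ _)) s
    _ ≤ affinity μ u F ^ s.card := by
        gcongr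
        exact lintegral_div_rpow_half_withDensity_le hu hF

lemma measure_exists_prod_le_prod_le (hX : ∀ i, Measurable (X i)) (hindep : iIndepFun X P)
    (hlaw : ∀ i, P.map (X i) = μ.withDensity F) (hF : AEMeasurable F μ)
    (hF1 : ∫⁻ x, F x ∂μ = 1) {S : Set α} {η a : ℝ≥0∞} {N : ℝ} {G : Set (α → ℝ≥0∞)}
    (hG : HasUpperBrackets μ S η N G) (hmeas : ∀ g ∈ G, AEMeasurable g μ)
    (ha : ∀ g ∈ G, affinity μ g F ≤ a) (s : Finset ι) :
    P {ω | (∀ i ∈ s, X i ω ∈ S) ∧ ∃ g ∈ G, ∏ i ∈ s, F (X i ω) ≤ ∏ i ∈ s, g (X i ω)}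
      ≤ ENNReal.ofReal N * (a + η ^ (1 / 2 : ℝ)) ^ s.card := by
  classical
  obtain ⟨𝒰, hcard, hbr⟩ := hG
  set 𝒱 := 𝒰.filter fun u => ∃ g ∈ G, IsUpperBracket μ S η g u
  have hcard' : (𝒱.card : ℝ≥0∞) ≤ ENNReal.ofReal N := by
    rw [← ENNReal.ofReal_natCast]
    exact ENNReal.ofReal_le_ofReal
      ((Nat.cast_le.2 (Finset.card_filter_le _ _)).trans hcard)
  have hbound : ∀ u ∈ 𝒱, P {ω | ∏ i ∈ s, F (X i ω) ≤ ∏ i ∈ s, u (X i ω)}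
      ≤ (a + η ^ (1 / 2 : ℝ)) ^ s.card := by
    intro u hu
    obtain ⟨g, hg, hgu⟩ := (Finset.mem_filter.1 hu).2
    refine (measure_prod_le_prod_le hX hindep hlaw hF (hF1.trans_ne ENNReal.one_ne_top)
      hgu.aemeasurable s).trans ?_
    gcongr
    have h := hgu.affinity_le (hmeas g hg) hF
    rw [hF1, ENNReal.one_rpow, mul_one] at h
    exact h.trans (add_le_add_left (ha g hg) _)
  calc _ ≤ P (⋃ u ∈ 𝒱, {ω | ∏ i ∈ s, F (X i ω) ≤ ∏ i ∈ s, u (X i ω)}) := by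
        refine measure_mono ?_
        rintro ω ⟨hS, g, hg, hle⟩
        obtain ⟨u, hu, hgu⟩ := hbr g hg
        exact Set.mem_biUnion (Finset.mem_filter.2 ⟨hu, g, hg, hgu⟩)
          (hle.trans (Finset.prod_le_prod' fun i hi => hgu.le_on _ (hS i hi)))
    _ ≤ ∑ u ∈ 𝒱, P {ω | ∏ i ∈ s, F (X i ω) ≤ ∏ i ∈ s, u (X i ω)} :=
        measure_biUnion_finset_le _ _
    _ ≤ 𝒱.card * (a + η ^ (1 / 2 : ℝ)) ^ s.card := by
        simpa only [nsmul_eq_mul] using Finset.sum_le_card_nsmul _ _ _ hbound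
    _ ≤ ENNReal.ofReal N * (a + η ^ (1 / 2 : ℝ)) ^ s.card := by gcongr

end LargeDeviations

section SieveConsistency

variable {α Ω : Type*} [MeasurableSpace α] [MeasurableSpace Ω] {μ : Measure α}
  {P : Measure Ω} {X : ℕ → Ω → α} {F : α → ℝ≥0∞} {S : ℕ → Set α} {G : ℕ → Set (α → ℝ≥0∞)}

/-- The classes `G n` have, for every fixed excess and over the sets `S n`, bracketing numbers of
subexponential growth in `n`. Growth is measured by summability against `exp (-τ n)`, which is
what Borel–Cantelli needs. -/
def HasSubexponentialBrackets (μ : Measure α) (S : ℕ → Set α) (G : ℕ → Set (α → ℝ≥0∞)) : Prop :=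
  ∀ η : ℝ, 0 < η → ∃ N : ℕ → ℝ, (∀ τ : ℝ, 0 < τ → Summable fun n => N n * Real.exp (-(τ * n))) ∧
    ∀ n, HasUpperBrackets μ (S n) (ENNReal.ofReal η) (N n) (G n)

lemma ae_eventually_notMem_of_summable {s : ℕ → Set Ω} {b : ℕ → ℝ} (hb : Summable b)
    (h : ∀ n, P (s n) ≤ ENNReal.ofReal (b n)) : ∀ᵐ ω ∂P, ∀ᶠ n in atTop, ω ∉ s n :=
  ae_eventually_notMem (ne_top_of_le_ne_top hb.tsum_ofReal_ne_top (ENNReal.tsum_le_tsum h))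

lemma affinity_bound_add_bracket_error_le {δ : ℝ} (hδ : δ ^ 2 ≤ 1) :
    ENNReal.ofReal (1 - δ ^ 2 / 2) + ENNReal.ofReal ((δ ^ 2 / 4) ^ 2) ^ (1 / 2 : ℝ)
      ≤ ENNReal.ofReal (Real.exp (-(δ ^ 2 / 4))) := by
  rw [ENNReal.ofReal_rpow_of_nonneg (by positivity) (by norm_num), ← Real.sqrt_eq_rpow,
    Real.sqrt_sq (by positivity), ← ENNReal.ofReal_add (by linarith) (by positivity)]
  exact ENNReal.ofReal_le_ofReal
    (by linarith [Real.add_one_le_exp (-(δ ^ 2 / 4))])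

variable (hX : ∀ i, Measurable (X i)) (hindep : iIndepFun X P)
  (hlaw : ∀ i, P.map (X i) = μ.withDensity F) (hF : AEMeasurable F μ) (hF1 : ∫⁻ x, F x ∂μ = 1)
  (hS : ∀ᵐ ω ∂P, ∀ᶠ n in atTop, ∀ i < n, X i ω ∈ S n)
  (hmeas : ∀ n, ∀ g ∈ G n, AEMeasurable g μ) (hG1 : ∀ n, ∀ g ∈ G n, ∫⁻ x, g x ∂μ = 1)
  (hG : HasSubexponentialBrackets μ S G)

include hX hindep hlaw hF hF1 hS hmeas hG1 hG

lemma ae_eventually_prod_lt_of_le_lintegral_sub {δ : ℝ} (hδ : 0 < δ) (hδ1 : δ ≤ 1) :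
    ∀ᵐ ω ∂P, ∀ᶠ n in atTop, ∀ g ∈ G n, ENNReal.ofReal δ ≤ ∫⁻ x, (g x - F x) ∂μ →
      ∏ i ∈ Finset.range n, g (X i ω) < ∏ i ∈ Finset.range n, F (X i ω) := by
  obtain ⟨N, hN, hbr⟩ := hG ((δ ^ 2 / 4) ^ 2) (by positivity)
  set Gfar : ℕ → Set (α → ℝ≥0∞) := fun n =>
    {g | g ∈ G n ∧ ENNReal.ofReal δ ≤ ∫⁻ x, (g x - F x) ∂μ}
  have hfar (n : ℕ) :
      P {ω | (∀ i ∈ Finset.range n, X i ω ∈ S n) ∧ ∃ g ∈ Gfar n,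
        ∏ i ∈ Finset.range n, F (X i ω) ≤ ∏ i ∈ Finset.range n, g (X i ω)}
      ≤ ENNReal.ofReal (N n * Real.exp (-(δ ^ 2 / 4 * n))) := by
    calc _ ≤ ENNReal.ofReal (N n) * (ENNReal.ofReal (1 - δ ^ 2 / 2)
          + ENNReal.ofReal ((δ ^ 2 / 4) ^ 2) ^ (1 / 2 : ℝ)) ^ (Finset.range n).card :=
          measure_exists_prod_le_prod_le hX hindep hlaw hF hF1
            ((hbr n).mono le_rfl le_rfl (Set.sep_subset _ _)) (fun g hg => hmeas n g hg.1)
            (fun g hg => affinity_le_of_le_lintegral_sub (hmeas n g hg.1) hF (hG1 n g hg.1) hF1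
              hδ.le hg.2) _
      _ ≤ ENNReal.ofReal (N n) * ENNReal.ofReal (Real.exp (-(δ ^ 2 / 4))) ^ n := by
          rw [Finset.card_range]
          gcongr
          exact affinity_bound_add_bracket_error_le (pow_le_one₀ hδ.le hδ1)
      _ = ENNReal.ofReal (N n * Real.exp (-(δ ^ 2 / 4 * n))) := by
          rw [← ENNReal.ofReal_pow (Real.exp_pos _).le, ← Real.exp_nat_mul,
            ← ENNReal.ofReal_mul' (Real.exp_pos _).le]
          ring_nf
  filter_upwards [ae_eventually_notMem_of_summable (hN _ (by positivity)) hfar, hS] with ω hω hSω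
  filter_upwards [hω, hSω] with n hn hSn g hg hδg
  by_contra hle
  exact hn ⟨fun i hi => hSn i (Finset.mem_range.1 hi), g, ⟨hg, hδg⟩, not_lt.1 hle⟩

theorem ae_tendsto_lintegral_sub_of_prod_le {ghat : ℕ → Ω → α → ℝ≥0∞}
    (hghat : ∀ᵐ ω ∂P, ∀ᶠ n in atTop, ghat n ω ∈ G n ∧
      ∏ i ∈ Finset.range n, F (X i ω) ≤ ∏ i ∈ Finset.range n, ghat n ω (X i ω)) :
    ∀ᵐ ω ∂P, Tendsto (fun n => ∫⁻ x, (ghat n ω x - F x) ∂μ) atTop (𝓝 0) := by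
  have hfar (k : ℕ) := ae_eventually_prod_lt_of_le_lintegral_sub hX hindep hlaw hF hF1 hS hmeas
    hG1 hG (δ := 1 / (k + 1)) (by positivity) (div_le_self zero_le_one (by simp))
  filter_upwards [ae_all_iff.2 hfar, hghat] with ω hω hmax
  refine ENNReal.tendsto_nhds_zero.2 fun ε hε => ?_
  have hlim : Tendsto (fun k : ℕ => ENNReal.ofReal (1 / ((k : ℝ) + 1))) atTop (𝓝 0) := by
    simpa using ENNReal.tendsto_ofReal tendsto_one_div_add_atTop_nhds_zero_nat
  obtain ⟨k, hk⟩ := (hlim.eventually_lt_const hε).exists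
  filter_upwards [hω k, hmax] with n hn hle
  by_contra! hlt
  exact (hn _ hle.1 (hk.trans hlt).le).not_ge hle.2

end SieveConsistency

section ExponentialRates

lemma summable_exp_mul_rpow_sub {d : ℝ} (hd : d < 1) (k : ℝ) {τ : ℝ} (hτ : 0 < τ) :
    Summable fun n : ℕ => Real.exp (k * (n : ℝ) ^ d - τ * n) := by
  have hlim : Tendsto (fun n : ℕ => k * (n : ℝ) ^ (-(1 - d))) atTop (𝓝 0) := by
    simpa using ((tendsto_rpow_neg_atTop (sub_pos.2 hd)).comp
      tendsto_natCast_atTop_atTop).const_mul k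
  have hgeom : Summable fun n : ℕ => Real.exp (n * (-(τ / 2))) :=
    Real.summable_exp_nat_mul_iff.2 (by linarith)
  refine hgeom.of_norm_bounded_eventually_nat ?_
  filter_upwards [hlim.eventually_le_const (half_pos hτ), eventually_gt_atTop 0] with n hn hn0
  have hnpos : (0 : ℝ) < n := Nat.cast_pos.2 hn0
  have hsplit : (n : ℝ) ^ d = (n : ℝ) ^ (-(1 - d)) * n := by
    rw [← Real.rpow_add_one hnpos.ne']
    ring_nf
  rw [Real.norm_of_nonneg (Real.exp_pos _).le, Real.exp_le_exp, hsplit, ← mul_assoc]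
  linarith [mul_le_mul_of_nonneg_right hn hnpos.le]

lemma summable_exp_neg_mul_rpow {d p : ℝ} (hd : 0 < d) (hp : 0 < p) :
    Summable fun n : ℕ => Real.exp (-p * (n : ℝ) ^ d) := by
  have hlim : Tendsto (fun n : ℕ => (n : ℝ) ^ d) atTop atTop :=
    (tendsto_rpow_atTop hd).comp tendsto_natCast_atTop_atTop
  have hO := ((isLittleO_exp_neg_mul_rpow_atTop hp (-2 / d)).comp_tendsto hlim).isBigO
  refine summable_of_isBigO_nat (Real.summable_nat_rpow.2 (show (-2 : ℝ) < -1 by norm_num))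
    (hO.congr_right fun n => ?_)
  rw [Function.comp_apply, ← Real.rpow_mul n.cast_nonneg, mul_div_cancel₀ _ hd.ne']

lemma eventually_forall_lt_le {R : Type*} [LinearOrder R] {x a : ℕ → R} (ha : Monotone a)
    (hlim : Tendsto a atTop atTop) (h : ∀ᶠ n in atTop, x n ≤ a n) :
    ∀ᶠ n in atTop, ∀ i < n, x i ≤ a n := by
  obtain ⟨n₀, hn₀⟩ := eventually_atTop.1 h
  have hinit : ∀ᶠ n in atTop, ∀ i ∈ Set.Iio n₀, x i ≤ a n :=
    (Set.finite_Iio n₀).eventually_all.2 fun i _ => hlim.eventually_ge_atTop (x i)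
  filter_upwards [hinit] with n hn i hi
  rcases lt_or_ge i n₀ with hlt | hge
  · exact hn i hlt
  · exact (hn₀ i hge).trans (ha hi.le)

lemma tendsto_exp_natCast_rpow_atTop {d : ℝ} (hd : 0 < d) :
    Tendsto (fun n : ℕ => Real.exp ((n : ℝ) ^ d)) atTop atTop :=
  Real.tendsto_exp_atTop.comp ((tendsto_rpow_atTop hd).comp tendsto_natCast_atTop_atTop)

end ExponentialRates

section TailDomination

/-- `g` is dominated by the envelope `C * (1 + |x|) ^ (-β)`, the form in which `TailBound` is
used: it combines the two bounds and has no singularity at `0`. -/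
def TailDominated (C β : ℝ) (g : ℝ → ℝ) : Prop := ∀ x, g x ≤ C * (1 + |x|) ^ (-β)

lemma rpow_neg_le_mul_rpow_neg {a b k β : ℝ} (ha : 0 < a) (hb : 0 < b) (hk : 0 < k) (hβ : 0 ≤ β)
    (h : b ≤ k * a) : a ^ (-β) ≤ k ^ β * b ^ (-β) := by
  calc a ^ (-β) = k ^ β * (k * a) ^ (-β) := by
        rw [Real.mul_rpow hk.le ha.le, ← mul_assoc, ← Real.rpow_add hk, add_neg_cancel,
          Real.rpow_zero, one_mul]
    _ ≤ k ^ β * b ^ (-β) := by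
        have := Real.rpow_le_rpow_of_nonpos hb h (neg_nonpos.2 hβ)
        gcongr

lemma TailBound.exists_tailDominated {M : ℕ} {f : Fin M → ℝ → ℝ} (h : TailBound f) :
    ∃ D β : ℝ, 0 ≤ D ∧ 1 < β ∧ ∀ m, TailDominated D β (f m) := by
  obtain ⟨v₀, v₁, β, hv₀, hv₁, hβ, hf⟩ := h
  refine ⟨(v₀ + v₁) * 2 ^ β, β, by positivity, hβ, fun m x => ?_⟩
  have hβ0 : 0 ≤ β := by linarith
  rw [mul_assoc]
  rcases le_total |x| 1 with hx | hx
  · calc f m x ≤ (v₀ + v₁) * 1 ^ (-β) := by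
          rw [Real.one_rpow]
          linarith [(hf m x).1]
      _ ≤ (v₀ + v₁) * (2 ^ β * (1 + |x|) ^ (-β)) := by
          have := rpow_neg_le_mul_rpow_neg one_pos (by positivity : 0 < 1 + |x|) two_pos hβ0
            (by linarith)
          gcongr
  · have hx0 : 0 < |x| := by linarith
    calc f m x ≤ v₁ * |x| ^ (-β) := (hf m x).2 (abs_pos.1 hx0)
      _ ≤ (v₀ + v₁) * (2 ^ β * (1 + |x|) ^ (-β)) := by
          have := rpow_neg_le_mul_rpow_neg hx0 (by positivity : 0 < 1 + |x|) two_pos hβ0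
            (by linarith)
          gcongr
          linarith

lemma TailDominated.mono {C C' β : ℝ} {g : ℝ → ℝ} (h : TailDominated C β g) (hC : C ≤ C') :
    TailDominated C' β g := fun x => (h x).trans (by gcongr)

lemma TailDominated.locScale {D β μ σ : ℝ} {φ : ℝ → ℝ} (hφ : TailDominated D β φ) (hD : 0 ≤ D)
    (hβ : 0 ≤ β) (hσ : 0 < σ) :
    TailDominated (1 / σ * (D * (1 + |μ| + σ) ^ β)) β (locScale φ μ σ) := by
  intro x
  obtain ⟨y, rfl⟩ : ∃ y, x = μ + σ * y := ⟨(x - μ) / σ, by field_simp; ring⟩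
  have hcompare : 1 + |μ + σ * y| ≤ (1 + |μ| + σ) * (1 + |y|) := by
    have := abs_add_le μ (σ * y)
    rw [abs_mul, abs_of_pos hσ] at this
    nlinarith [mul_nonneg (abs_nonneg μ) (abs_nonneg y), abs_nonneg y]
  have henvelope := rpow_neg_le_mul_rpow_neg (by positivity) (by positivity) (by positivity) hβ
    hcompare
  calc LocScaleMixture.locScale φ μ σ (μ + σ * y) = 1 / σ * φ y := by
        rw [LocScaleMixture.locScale, add_sub_cancel_left, mul_div_cancel_left₀ _ hσ.ne']
    _ ≤ 1 / σ * (D * ((1 + |μ| + σ) ^ β * (1 + |μ + σ * y|) ^ (-β))) := by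
        gcongr
        exact (hφ y).trans (by gcongr)
    _ = 1 / σ * (D * (1 + |μ| + σ) ^ β) * (1 + |μ + σ * y|) ^ (-β) := by ring

lemma TailDominated.locScale_le_div {D β μ σ : ℝ} {φ : ℝ → ℝ} (hφ : TailDominated D β φ)
    (hD : 0 ≤ D) (hβ : 1 ≤ β) (hσ : 0 < σ) (x : ℝ) :
    LocScaleMixture.locScale φ μ σ x ≤ D / (σ + |x - μ|) := by
  set y := (x - μ) / σ with hy
  have hpow : (1 + |y|) ^ (-β) ≤ (1 + |y|)⁻¹ := by
    rw [← Real.rpow_neg_one]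
    exact Real.rpow_le_rpow_of_exponent_le (by linarith [abs_nonneg y]) (by linarith)
  calc LocScaleMixture.locScale φ μ σ x = 1 / σ * φ y := rfl
    _ ≤ 1 / σ * (D * (1 + |y|)⁻¹) := by
        gcongr
        exact (hφ y).trans (by gcongr)
    _ = D / (σ + |x - μ|) := by
        rw [hy, abs_div, abs_of_pos hσ]
        field_simp

lemma integrable_envelope (C : ℝ) {β : ℝ} (hβ : 1 < β) :
    Integrable fun x : ℝ => C * (1 + |x|) ^ (-β) :=
  (integrable_one_add_norm (E := ℝ) (by simpa using hβ)).const_mul C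

lemma TailDominated.exists_withDensity_le {C β : ℝ} {g : ℝ → ℝ} (h : TailDominated C β g)
    (hC : 0 ≤ C) (hβ : 1 < β) :
    ∃ I p : ℝ, 0 < p ∧ ∀ A : ℝ, 0 < A →
      volume.withDensity (fun x => ENNReal.ofReal (g x)) {x | A < |x|}
        ≤ ENNReal.ofReal (I * A ^ (-p)) := by
  -- Half of the excess of `β` over `1` pays for integrability, the other half for the decay.
  obtain ⟨p, hp, hpβ⟩ : ∃ p, 0 < p ∧ 1 < β - p := ⟨(β - 1) / 2, by linarith, by linarith⟩
  refine ⟨∫ x : ℝ, C * (1 + |x|) ^ (-(β - p)), p, hp, fun A hA => ?_⟩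
  have hset : MeasurableSet {x : ℝ | A < |x|} :=
    measurableSet_lt measurable_const continuous_abs.measurable
  have hbound (x : ℝ) (hx : A < |x|) : g x ≤ C * (1 + |x|) ^ (-(β - p)) * A ^ (-p) := by
    have hdecay : (1 + |x|) ^ (-p) ≤ A ^ (-p) :=
      Real.rpow_le_rpow_of_nonpos hA (by linarith) (by linarith)
    calc g x ≤ C * (1 + |x|) ^ (-β) := h x
      _ = C * (1 + |x|) ^ (-(β - p)) * (1 + |x|) ^ (-p) := by
          rw [mul_assoc, ← Real.rpow_add (by positivity)]
          ring_nf
      _ ≤ _ := by gcongr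
  calc volume.withDensity (fun x => ENNReal.ofReal (g x)) {x | A < |x|}
      = ∫⁻ x in {x | A < |x|}, ENNReal.ofReal (g x) := withDensity_apply _ hset
    _ ≤ ∫⁻ x in {x | A < |x|}, ENNReal.ofReal (C * (1 + |x|) ^ (-(β - p)) * A ^ (-p)) :=
        setLIntegral_mono' hset fun x hx => ENNReal.ofReal_le_ofReal (hbound x hx)
    _ ≤ ∫⁻ x, ENNReal.ofReal (C * (1 + |x|) ^ (-(β - p)) * A ^ (-p)) :=
        setLIntegral_le_lintegral _ _
    _ = ENNReal.ofReal ((∫ x : ℝ, C * (1 + |x|) ^ (-(β - p))) * A ^ (-p)) := by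
        rw [← integral_mul_const, ofReal_integral_eq_lintegral_ofReal
          ((integrable_envelope C hpβ).mul_const _) (ae_of_all _ fun x => by positivity)]

lemma ae_eventually_forall_abs_le {Ω : Type*} [MeasurableSpace Ω] {P : Measure Ω}
    {X : ℕ → Ω → ℝ} (hX : ∀ i, Measurable (X i)) {ν : Measure ℝ} (hlaw : ∀ i, P.map (X i) = ν)
    {I p : ℝ} (hp : 0 < p)
    (htail : ∀ A : ℝ, 0 < A → ν {x | A < |x|} ≤ ENNReal.ofReal (I * A ^ (-p)))
    {d : ℝ} (hd : 0 < d) :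
    ∀ᵐ ω ∂P, ∀ᶠ n : ℕ in atTop, ∀ i < n, |X i ω| ≤ Real.exp ((n : ℝ) ^ d) := by
  have hsum : Summable fun n : ℕ => I * Real.exp (-p * (n : ℝ) ^ d) :=
    (summable_exp_neg_mul_rpow hd hp).mul_left I
  have hsingle (n : ℕ) : P {ω | Real.exp ((n : ℝ) ^ d) < |X n ω|}
      ≤ ENNReal.ofReal (I * Real.exp (-p * (n : ℝ) ^ d)) := by
    have hset : MeasurableSet {x : ℝ | Real.exp ((n : ℝ) ^ d) < |x|} :=
      measurableSet_lt measurable_const continuous_abs.measurable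
    have h := htail (Real.exp ((n : ℝ) ^ d)) (Real.exp_pos _)
    rwa [← hlaw n, Measure.map_apply (hX n) hset, ← Real.exp_mul, mul_comm _ (-p)] at h
  filter_upwards [ae_eventually_notMem_of_summable hsum hsingle] with ω hω
  refine eventually_forall_lt_le (fun m n hmn => ?_) (tendsto_exp_natCast_rpow_atTop hd)
    (hω.mono fun n hn => not_lt.1 hn)
  gcongr

end TailDomination

section Densities

lemma quasiMeasurePreserving_affine (μ : ℝ) {σ : ℝ} (hσ : 0 < σ) :
    Measure.QuasiMeasurePreserving (fun x : ℝ => (x - μ) / σ) volume volume := by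
  have hscale := Measure.quasiMeasurePreserving_smul (volume : Measure ℝ) (inv_ne_zero hσ.ne')
  have hshift := (measurePreserving_sub_right (volume : Measure ℝ) μ).quasiMeasurePreserving
  simpa only [Function.comp_def, smul_eq_mul, div_eq_inv_mul] using hscale.comp hshift

lemma lintegral_affine (g : ℝ → ℝ≥0∞) (μ : ℝ) {σ : ℝ} (hσ : 0 < σ) :
    ∫⁻ x, ENNReal.ofReal (1 / σ) * g ((x - μ) / σ) = ∫⁻ x, g x := by
  have hscale := lintegral_map_equiv (μ := volume) g
    (Homeomorph.mulLeft₀ σ⁻¹ (inv_ne_zero hσ.ne')).toMeasurableEquiv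
  simp only [Homeomorph.toMeasurableEquiv_coe, Homeomorph.coe_mulLeft₀,
    Real.map_volume_mul_left (inv_ne_zero hσ.ne'), lintegral_smul_measure, inv_inv, abs_of_pos hσ,
    smul_eq_mul] at hscale
  rw [lintegral_const_mul' _ _ ENNReal.ofReal_ne_top,
    lintegral_sub_right_eq_self (fun x => g (x / σ)) μ]
  simp only [div_eq_inv_mul, mul_one]
  rw [← hscale, ← mul_assoc, ← ENNReal.ofReal_mul (inv_nonneg.2 hσ.le), inv_mul_cancel₀ hσ.ne',
    ENNReal.ofReal_one, one_mul]

lemma ofReal_locScale (φ : ℝ → ℝ) (μ : ℝ) {σ : ℝ} (hσ : 0 < σ) (x : ℝ) :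
    ENNReal.ofReal (locScale φ μ σ x)
      = ENNReal.ofReal (1 / σ) * ENNReal.ofReal (φ ((x - μ) / σ)) :=
  ENNReal.ofReal_mul (by positivity)

lemma IsDensity.locScale {φ : ℝ → ℝ} (h : IsDensity φ) (μ : ℝ) {σ : ℝ} (hσ : 0 < σ) :
    IsDensity (locScale φ μ σ) := by
  refine ⟨(h.1.comp_quasiMeasurePreserving (quasiMeasurePreserving_affine μ hσ)).const_mul _,
    fun x => mul_nonneg (by positivity) (h.2.1 _), ?_⟩
  simp only [ofReal_locScale φ μ hσ]
  rw [lintegral_affine (fun x => ENNReal.ofReal (φ x)) μ hσ, h.2.2]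

lemma IsDensity.eLpNorm_sub_one {p q : ℝ → ℝ} (hp : IsDensity p) (hq : IsDensity q) :
    eLpNorm (fun x => p x - q x) 1 volume
      = 2 * ∫⁻ x, (ENNReal.ofReal (p x) - ENNReal.ofReal (q x)) :=
  eLpNorm_sub_one_eq_two_mul_lintegral hp.1 hq.1 hp.2.1 hq.2.1 (hp.2.2.trans hq.2.2.symm)
    (hq.2.2.trans_ne ENNReal.one_ne_top)

variable {M : ℕ} {f : Fin M → ℝ → ℝ} {θ : Param M}

lemma ofReal_mixture (hf : ∀ m, IsDensity (f m)) (hθ : θ ∈ paramSpace M) (x : ℝ) :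
    ENNReal.ofReal (mixture f θ x) = ∑ m, ENNReal.ofReal (θ.weight m) *
      ENNReal.ofReal (locScale (f m) (θ.loc m) (θ.scale m) x) := by
  have hcomp (m : Fin M) := (hf m).locScale (θ.loc m) (hθ.2.2 m)
  rw [mixture, ENNReal.ofReal_sum_of_nonneg fun m _ => mul_nonneg (hθ.2.1 m) ((hcomp m).2.1 x)]
  exact Finset.sum_congr rfl fun m _ => ENNReal.ofReal_mul (hθ.2.1 m)

lemma IsDensity.mixture (hf : ∀ m, IsDensity (f m)) (hθ : θ ∈ paramSpace M) :
    IsDensity (mixture f θ) := by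
  have hcomp (m : Fin M) := (hf m).locScale (θ.loc m) (hθ.2.2 m)
  refine ⟨Finset.aemeasurable_fun_sum _ fun m _ => (hcomp m).1.const_mul _,
    fun x => Finset.sum_nonneg fun m _ => mul_nonneg (hθ.2.1 m) ((hcomp m).2.1 x), ?_⟩
  simp only [ofReal_mixture hf hθ]
  rw [lintegral_finsetSum' _ fun m _ => (hcomp m).1.ennreal_ofReal.const_mul _]
  simp only [lintegral_const_mul' _ _ ENNReal.ofReal_ne_top, (hcomp _).2.2, mul_one]
  rw [← ENNReal.ofReal_sum_of_nonneg fun m _ => hθ.2.1 m, hθ.1, ENNReal.ofReal_one]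

end Densities

section LocalMajorants

lemma tendsto_sSup_image_closedBall {E : Type*} [PseudoMetricSpace E] {T : Set E} {a : E}
    (ha : a ∈ T) {h : E → ℝ} (hcont : ContinuousWithinAt h T a) :
    Tendsto (fun ρ => sSup (h '' {b | b ∈ T ∧ dist b a ≤ ρ})) (𝓝[>] 0) (𝓝 (h a)) := by
  refine Metric.tendsto_nhds.2 fun ε hε => ?_
  obtain ⟨r, hr, hclose⟩ := Metric.continuousWithinAt_iff.1 hcont (ε / 2) (half_pos hε)
  filter_upwards [Ioo_mem_nhdsGT hr] with ρ hρ
  have hle : ∀ y ∈ h '' {b | b ∈ T ∧ dist b a ≤ ρ}, y ≤ h a + ε / 2 := by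
    rintro _ ⟨b, ⟨hbT, hb⟩, rfl⟩
    linarith [(abs_lt.1 (hclose hbT (hb.trans_lt hρ.2))).2]
  have hmem : h a ∈ h '' {b | b ∈ T ∧ dist b a ≤ ρ} := ⟨a, ⟨ha, by simpa using hρ.1.le⟩, rfl⟩
  have hlower := le_csSup ⟨_, hle⟩ hmem
  have hupper := csSup_le ⟨_, hmem⟩ hle
  rw [Real.dist_eq, abs_lt]
  constructor <;> linarith

lemma eventually_forall_dist_le {E : Type*} [PseudoMetricSpace E] {T : Set E} {a : E}
    {p : E → Prop} (h : ∀ᶠ b in 𝓝[T] a, p b) :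
    ∀ᶠ ρ in 𝓝[>] (0 : ℝ), ∀ b ∈ T, dist b a ≤ ρ → p b := by
  obtain ⟨r, hr, hball⟩ := Metric.mem_nhdsWithin_iff.1 h
  filter_upwards [Ioo_mem_nhdsGT hr] with ρ hρ b hbT hb
  exact hball ⟨Metric.mem_ball.2 (hb.trans_lt hρ.2), hbT⟩

lemma tendsto_lintegral_of_dominated_of_aemeasurable {α ι : Type*} [MeasurableSpace α]
    {μ : Measure α} {l : Filter ι} [l.IsCountablyGenerated] {F : ι → α → ℝ≥0∞}
    {g bound : α → ℝ≥0∞} (hF : ∀ᶠ i in l, AEMeasurable (F i) μ)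
    (hbound : ∀ᶠ i in l, ∀ᵐ x ∂μ, F i x ≤ bound x) (hfin : ∫⁻ x, bound x ∂μ ≠ ⊤)
    (hlim : ∀ᵐ x ∂μ, Tendsto (fun i => F i x) l (𝓝 (g x))) :
    Tendsto (fun i => ∫⁻ x, F i x ∂μ) l (𝓝 (∫⁻ x, g x ∂μ)) := by
  refine tendsto_of_seq_tendsto fun u hu => ?_
  obtain ⟨k, hk⟩ := (hu.eventually (hF.and hbound)).exists_forall_of_atTop
  rw [← tendsto_add_atTop_iff_nat k]
  refine tendsto_lintegral_of_dominated_convergence' bound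
    (fun n => (hk _ (Nat.le_add_left k n)).1) (fun n => (hk _ (Nat.le_add_left k n)).2) hfin ?_
  filter_upwards [hlim] with x hx
  exact (hx.comp hu).comp (tendsto_add_atTop_nat k)

variable {M : ℕ} {f : Fin M → ℝ → ℝ} {θ : Param M}

@[fun_prop]
lemma Param.continuous_weight (m : Fin M) : Continuous fun θ : Param M => θ.weight m := by
  unfold Param.weight
  fun_prop

@[fun_prop]
lemma Param.continuous_loc (m : Fin M) : Continuous fun θ : Param M => θ.loc m := by
  unfold Param.loc
  fun_prop

@[fun_prop]
lemma Param.continuous_scale (m : Fin M) : Continuous fun θ : Param M => θ.scale m := by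
  unfold Param.scale
  fun_prop

lemma exists_isCompact_subset_paramSpace (hθ : θ ∈ paramSpace M) :
    ∃ Γ ⊆ paramSpace M, IsCompact Γ ∧ Γ ∈ 𝓝[paramSpace M] θ := by
  have hclosed : IsClosed {θ : Param M | (∑ m, θ.weight m = 1) ∧ ∀ m, 0 ≤ θ.weight m} := by
    simp only [Set.ofPred_and, Set.ofPred_forall]
    exact (isClosed_eq (by fun_prop) continuous_const).inter
      (isClosed_iInter fun m => isClosed_le continuous_const (by fun_prop))
  have hopen : IsOpen {θ : Param M | ∀ m, 0 < θ.scale m} := by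
    simp only [Set.ofPred_forall]
    exact isOpen_iInter_of_finite fun m => isOpen_lt continuous_const (by fun_prop)
  obtain ⟨K, hKnhds, hKpos, hK⟩ := local_compact_nhds (hopen.mem_nhds hθ.2.2)
  refine ⟨K ∩ {θ | (∑ m, θ.weight m = 1) ∧ ∀ m, 0 ≤ θ.weight m},
    fun θ' h => ⟨h.2.1, h.2.2, hKpos h.1⟩, hK.inter_right hclosed, ?_⟩
  filter_upwards [mem_nhdsWithin_of_mem_nhds hKnhds, self_mem_nhdsWithin] with θ' hθ'K hθ'
  exact ⟨hθ'K, hθ'.1, hθ'.2.1⟩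

lemma ContinuousInParam.ae_continuousWithinAt (h3 : ContinuousInParam f)
    (hθ : θ ∈ paramSpace M) :
    ∀ᵐ x, ContinuousWithinAt (fun θ' => mixture f θ' x) (paramSpace M) θ := by
  obtain ⟨Γ, hΓ, hΓc, hΓnhds⟩ := exists_isCompact_subset_paramSpace hθ
  obtain ⟨N, hN, hseq⟩ := h3 Γ hΓc hΓ θ (mem_of_mem_nhdsWithin hθ hΓnhds)
  filter_upwards [compl_mem_ae_iff.2 hN] with x hx
  have hcont : ContinuousWithinAt (fun θ' => mixture f θ' x) Γ θ := by
    refine tendsto_of_seq_tendsto fun u hu => ?_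
    obtain ⟨hlim, hmem⟩ := tendsto_nhdsWithin_iff.1 hu
    obtain ⟨k, hk⟩ := hmem.exists_forall_of_atTop
    rw [← tendsto_add_atTop_iff_nat k]
    exact hseq (fun n => u (n + k)) (fun n => hk _ (Nat.le_add_left k n))
      (hlim.comp (tendsto_add_atTop_nat k)) x hx
  exact hcont.mono_of_mem_nhdsWithin hΓnhds

/-- The constant of the envelope that the components' common envelope `D * (1 + |x|) ^ (-β)`
induces on the mixture with parameter `θ`. -/
def envelopeConst (D β : ℝ) (θ : Param M) : ℝ :=
  ∑ m, θ.weight m * (1 / θ.scale m * (D * (1 + |θ.loc m| + θ.scale m) ^ β))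

lemma envelopeConst_nonneg {D : ℝ} (hD : 0 ≤ D) (β : ℝ) (hθ : θ ∈ paramSpace M) :
    0 ≤ envelopeConst D β θ :=
  Finset.sum_nonneg fun m _ => by
    have := hθ.2.1 m
    have := hθ.2.2 m
    positivity

lemma continuousAt_envelopeConst (D β : ℝ) (hθ : θ ∈ paramSpace M) :
    ContinuousAt (envelopeConst D β) θ := by
  refine tendsto_finsetSum _ fun m _ => ?_
  have hscale : θ.scale m ≠ 0 := (hθ.2.2 m).ne'
  have hbase : 1 + |θ.loc m| + θ.scale m ≠ 0 := by
    have := hθ.2.2 m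
    positivity
  change ContinuousAt (fun θ : Param M => _) θ
  fun_prop (disch := first | assumption | exact Or.inl hbase)

lemma TailDominated.mixture {D β : ℝ} (hf : ∀ m, TailDominated D β (f m)) (hD : 0 ≤ D)
    (hβ : 0 ≤ β) (hθ : θ ∈ paramSpace M) :
    TailDominated (envelopeConst D β θ) β (mixture f θ) := by
  intro x
  rw [envelopeConst, Finset.sum_mul]
  refine Finset.sum_le_sum fun m _ => ?_
  rw [mul_assoc]
  exact mul_le_mul_of_nonneg_left ((hf m).locScale hD hβ (hθ.2.2 m) x) (hθ.2.1 m)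

lemma exists_eventually_tailDominated_mixture {D β : ℝ} (hf : ∀ m, TailDominated D β (f m))
    (hD : 0 ≤ D) (hβ : 0 ≤ β) (hθ : θ ∈ paramSpace M) :
    ∃ C, 0 ≤ C ∧ ∀ᶠ θ' in 𝓝[paramSpace M] θ, TailDominated C β (mixture f θ') := by
  refine ⟨envelopeConst D β θ + 1, add_nonneg (envelopeConst_nonneg hD β hθ) zero_le_one, ?_⟩
  filter_upwards [self_mem_nhdsWithin, mem_nhdsWithin_of_mem_nhds
    ((continuousAt_envelopeConst D β hθ).eventually_le_const (lt_add_one _))] with θ' hθ' hC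
  exact (TailDominated.mixture hf hD hβ hθ').mono hC

lemma tendsto_lintegral_mixtureSup (h1 : TailBound f) (h2 : LocalSupMeasurable f)
    (h3 : ContinuousInParam f) (hθ : θ ∈ paramSpace M) :
    Tendsto (fun ρ => ∫⁻ x, ENNReal.ofReal (mixtureSup f θ ρ x)) (𝓝[>] 0)
      (𝓝 (∫⁻ x, ENNReal.ofReal (mixture f θ x))) := by
  obtain ⟨D, β, hD, hβ, hf⟩ := h1.exists_tailDominated
  obtain ⟨C, hC, hdom⟩ := exists_eventually_tailDominated_mixture hf hD (by linarith) hθ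
  have hmeas : ∀ᶠ ρ in 𝓝[>] (0 : ℝ), AEMeasurable (mixtureSup f θ ρ) :=
    h2 {θ} isCompact_singleton (Set.singleton_subset_iff.2 hθ) θ rfl
  refine tendsto_lintegral_of_dominated_of_aemeasurable
    (bound := fun x => ENNReal.ofReal (C * (1 + |x|) ^ (-β)))
    (hmeas.mono fun ρ h => h.ennreal_ofReal) ?_ (integrable_envelope C hβ).lintegral_lt_top.ne ?_
  · filter_upwards [eventually_forall_dist_le hdom] with ρ hρ
    refine ae_of_all _ fun x => ENNReal.ofReal_le_ofReal (Real.sSup_le ?_ (by positivity))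
    rintro _ ⟨θ', ⟨hθ', hdist⟩, rfl⟩
    exact hρ θ' hθ' hdist x
  · filter_upwards [h3.ae_continuousWithinAt hθ] with x hx
    exact (ENNReal.continuous_ofReal.tendsto _).comp (tendsto_sSup_image_closedBall hθ hx)

lemma exists_eventually_isUpperBracket_mixture (hdens : ∀ m, IsDensity (f m)) (h1 : TailBound f)
    (h2 : LocalSupMeasurable f) (h3 : ContinuousInParam f) (hθ : θ ∈ paramSpace M) {η : ℝ≥0∞}
    (hη : η ≠ 0) :
    ∃ u, ∀ᶠ θ' in 𝓝[paramSpace M] θ,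
      IsUpperBracket volume Set.univ η (fun x => ENNReal.ofReal (mixture f θ' x)) u := by
  obtain ⟨D, β, hD, hβ, hf⟩ := h1.exists_tailDominated
  obtain ⟨C, -, hdom⟩ := exists_eventually_tailDominated_mixture hf hD (by linarith) hθ
  have hint : ∀ᶠ ρ in 𝓝[>] (0 : ℝ), ∫⁻ x, ENNReal.ofReal (mixtureSup f θ ρ x) ≤ 1 + η := by
    have hlim := tendsto_lintegral_mixtureSup h1 h2 h3 hθ
    rw [(IsDensity.mixture hdens hθ).2.2] at hlim
    exact hlim.eventually_le_const (ENNReal.lt_add_right ENNReal.one_ne_top hη)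
  have hmeas : ∀ᶠ ρ in 𝓝[>] (0 : ℝ), AEMeasurable (mixtureSup f θ ρ) :=
    h2 {θ} isCompact_singleton (Set.singleton_subset_iff.2 hθ) θ rfl
  obtain ⟨ρ, hρ, hρdom, hρint, hρmeas⟩ := (eventually_mem_nhdsWithin.and
    ((eventually_forall_dist_le hdom).and (hint.and hmeas))).exists
  refine ⟨fun x => ENNReal.ofReal (mixtureSup f θ ρ x), ?_⟩
  filter_upwards [self_mem_nhdsWithin,
    mem_nhdsWithin_of_mem_nhds (Metric.closedBall_mem_nhds θ hρ)] with θ' hθ' hdist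
  have hle (x : ℝ) : ENNReal.ofReal (mixture f θ' x) ≤ ENNReal.ofReal (mixtureSup f θ ρ x) := by
    refine ENNReal.ofReal_le_ofReal
      (le_csSup ⟨C * (1 + |x|) ^ (-β), ?_⟩ ⟨θ', ⟨hθ', hdist⟩, rfl⟩)
    rintro _ ⟨θ'', ⟨hθ'', hdist''⟩, rfl⟩
    exact hρdom θ'' hθ'' hdist'' x
  have hdens' := IsDensity.mixture hdens hθ'
  refine ⟨hρmeas.ennreal_ofReal, fun x _ => hle x, ?_⟩
  rw [lintegral_sub' hdens'.1.ennreal_ofReal (by simp [hdens'.2.2]) (ae_of_all _ hle),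
    hdens'.2.2]
  exact tsub_le_iff_left.2 hρint

end LocalMajorants

section Vertex

/-- The parameter with all the weight on the component `m`, which has location `μ` and scale `σ`;
the idle components have location `0` and scale `1`. -/
def vertex {M : ℕ} (m : Fin M) (μ σ : ℝ) : Param M :=
  WithLp.toLp 2 fun i => if i.1 = m then ![1, μ, σ] i.2 else ![0, 0, 1] i.2

variable {M : ℕ} (m : Fin M) (μ σ : ℝ)

lemma weight_vertex (k : Fin M) : (vertex m μ σ).weight k = if k = m then 1 else 0 := by
  by_cases h : k = m <;> simp [Param.weight, vertex, h]

lemma loc_vertex (k : Fin M) : (vertex m μ σ).loc k = if k = m then μ else 0 := by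
  by_cases h : k = m <;> simp [Param.loc, vertex, h]

lemma scale_vertex (k : Fin M) : (vertex m μ σ).scale k = if k = m then σ else 1 := by
  by_cases h : k = m <;> simp [Param.scale, vertex, h]

lemma vertex_mem_paramSpace {σ : ℝ} (hσ : 0 < σ) : vertex m μ σ ∈ paramSpace M := by
  refine ⟨by simp [weight_vertex], fun k => ?_, fun k => ?_⟩
  · rw [weight_vertex]
    split_ifs <;> norm_num
  · rw [scale_vertex]
    split_ifs <;> [exact hσ; norm_num]

lemma mixture_vertex (f : Fin M → ℝ → ℝ) (x : ℝ) :
    mixture f (vertex m μ σ) x = locScale (f m) μ σ x := by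
  simp [mixture, weight_vertex, loc_vertex, scale_vertex]

lemma continuous_vertex : Continuous fun p : ℝ × ℝ => vertex m p.1 p.2 := by
  refine (PiLp.continuous_toLp 2 _).comp (continuous_pi ?_)
  rintro ⟨k, j⟩
  by_cases h : k = m
  · simp only [if_pos h]
    fin_cases j
    exacts [continuous_const, continuous_fst, continuous_snd]
  · simp only [if_neg h]
    exact continuous_const

lemma tendsto_vertex_nhdsWithin {σ : ℝ} (hσ : 0 < σ) :
    Tendsto (fun p : ℝ × ℝ => vertex m p.1 p.2) (𝓝 (μ, σ)) (𝓝[paramSpace M] vertex m μ σ) := by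
  refine tendsto_nhdsWithin_iff.2 ⟨(continuous_vertex m).tendsto (μ, σ), ?_⟩
  filter_upwards [continuous_snd.continuousAt.eventually_const_lt hσ] with p hp
  exact vertex_mem_paramSpace m p.1 hp

end Vertex

section LocationScaleBrackets

lemma isUpperBracket_indicator_const {α : Type*} [MeasurableSpace α] {μ : Measure α} {s : Set α}
    {g : α → ℝ≥0∞} {b : ℝ≥0∞} (hs : MeasurableSet s) (h : ∀ x ∈ s, g x ≤ b) :
    IsUpperBracket μ s (b * μ s) g (s.indicator fun _ => b) where
  aemeasurable := (measurable_const.indicator hs).aemeasurable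
  le_on x hx := by
    rw [Set.indicator_of_mem hx]
    exact h x hx
  excess_le := (lintegral_mono fun x => tsub_le_self).trans_eq (lintegral_indicator_const hs b)

lemma IsUpperBracket.affine {s : Set ℝ} {η : ℝ≥0∞} {g u : ℝ → ℝ≥0∞}
    (h : IsUpperBracket volume s η g u) (ν : ℝ) {τ : ℝ} (hτ : 0 < τ) :
    IsUpperBracket volume ((fun x => (x - ν) / τ) ⁻¹' s) η
      (fun x => ENNReal.ofReal (1 / τ) * g ((x - ν) / τ))
      (fun x => ENNReal.ofReal (1 / τ) * u ((x - ν) / τ)) where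
  aemeasurable := (h.aemeasurable.comp_quasiMeasurePreserving
    (quasiMeasurePreserving_affine ν hτ)).const_mul _
  le_on x hx := mul_le_mul_right (h.le_on _ hx) _
  excess_le := by
    simp only [← ENNReal.mul_sub fun _ _ => ENNReal.ofReal_ne_top]
    exact (lintegral_affine (fun y => u y - g y) ν hτ).trans_le h.excess_le

lemma locScale_eq_rescale (φ : ℝ → ℝ) (μ σ ν : ℝ) {τ : ℝ} (hτ : 0 < τ) (x : ℝ) :
    locScale φ μ σ x = 1 / τ * locScale φ ((μ - ν) / τ) (σ / τ) ((x - ν) / τ) := by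
  have harg : ((x - ν) / τ - (μ - ν) / τ) / (σ / τ) = (x - μ) / σ := by
    rw [← sub_div, div_div_div_cancel_right₀ hτ.ne', sub_sub_sub_cancel_right]
  rw [locScale, locScale, harg]
  field_simp

/-- The members of the location-scale family generated by `φ` with scale at least `c`, as
`ℝ≥0∞`-valued functions. -/
def locScaleFamily (φ : ℝ → ℝ) (c : ℝ) : Set (ℝ → ℝ≥0∞) :=
  {g | ∃ μ σ : ℝ, c ≤ σ ∧ g = fun x => ENNReal.ofReal (locScale φ μ σ x)}

/-- `u` is a common upper bracket, with excess at most `η`, of the members of the location-scale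
family of `φ` whose parameters are within `ρ` of `(0, 1)`. -/
def IsLocalBracket (φ : ℝ → ℝ) (ρ η : ℝ) (u : ℝ → ℝ≥0∞) : Prop :=
  ∀ μ σ : ℝ, |μ| ≤ ρ → |σ - 1| ≤ ρ →
    IsUpperBracket volume Set.univ (ENNReal.ofReal η)
      (fun x => ENNReal.ofReal (locScale φ μ σ x)) u

lemma exists_isLocalBracket {M : ℕ} {f : Fin M → ℝ → ℝ} (hf : ∀ m, IsDensity (f m))
    (h1 : TailBound f) (h2 : LocalSupMeasurable f) (h3 : ContinuousInParam f) (m : Fin M) {η : ℝ}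
    (hη : 0 < η) : ∃ ρ u, 0 < ρ ∧ IsLocalBracket (f m) ρ η u := by
  obtain ⟨u, hu⟩ := exists_eventually_isUpperBracket_mixture hf h1 h2 h3
    (vertex_mem_paramSpace m 0 one_pos) (ENNReal.ofReal_pos.2 hη).ne'
  obtain ⟨ρ, hρ, hball⟩ := Metric.nhds_basis_closedBall.eventually_iff.1
    ((tendsto_vertex_nhdsWithin m 0 one_pos).eventually hu)
  refine ⟨ρ, u, hρ, fun μ σ hμ hσ => ?_⟩
  have hmem : (μ, σ) ∈ Metric.closedBall ((0 : ℝ), (1 : ℝ)) ρ := by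
    simpa [Prod.dist_eq, Real.dist_eq] using ⟨hμ, hσ⟩
  simpa only [mixture_vertex] using hball hmem

variable {φ : ℝ → ℝ} {D β η ρ A c μ σ : ℝ} {u : ℝ → ℝ≥0∞}

lemma TailDominated.locScale_le_of_far (hφ : TailDominated D β φ) (hD : 0 ≤ D) (hβ : 1 ≤ β)
    {b : ℝ} (hb : 0 < b) (hσ : 0 < σ) (hfar : D / b + A ≤ σ ∨ D / b + A ≤ |μ|) {x : ℝ}
    (hx : x ∈ Set.Icc (-A) A) : LocScaleMixture.locScale φ μ σ x ≤ b := by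
  have hxA := abs_le.2 (Set.mem_Icc.1 hx)
  refine (hφ.locScale_le_div hD hβ hσ x).trans ((div_le_iff₀ (by positivity)).2 ?_)
  have hdist : D / b ≤ σ + |x - μ| := by
    rcases hfar with h | h
    · linarith [abs_nonneg x, abs_nonneg (x - μ)]
    · linarith [abs_sub_abs_le_abs_sub μ x, abs_sub_comm μ x]
  rwa [div_le_iff₀' hb] at hdist

lemma isUpperBracket_locScale_of_far (hφ : TailDominated D β φ) (hD : 0 ≤ D) (hβ : 1 ≤ β)
    (hη : 0 < η) (hA : 0 < A) (hσ : 0 < σ)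
    (hfar : D / (η / (2 * A)) + A ≤ σ ∨ D / (η / (2 * A)) + A ≤ |μ|) :
    IsUpperBracket volume (Set.Icc (-A) A) (ENNReal.ofReal η)
      (fun x => ENNReal.ofReal (locScale φ μ σ x))
      ((Set.Icc (-A) A).indicator fun _ => ENNReal.ofReal (η / (2 * A))) := by
  refine (isUpperBracket_indicator_const measurableSet_Icc fun x hx => ENNReal.ofReal_le_ofReal
    (hφ.locScale_le_of_far hD hβ (by positivity) hσ hfar hx)).mono subset_rfl (le_of_eq ?_)
  rw [Real.volume_Icc, ← ENNReal.ofReal_mul (by positivity)]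
  congr 1
  field_simp
  ring

lemma IsLocalBracket.isUpperBracket_locScale (hu : IsLocalBracket φ ρ η u) {ν τ : ℝ} (hτ : 0 < τ)
    (hμ : |μ - ν| ≤ ρ * τ) (hσ : |σ - τ| ≤ ρ * τ) :
    IsUpperBracket volume Set.univ (ENNReal.ofReal η)
      (fun x => ENNReal.ofReal (locScale φ μ σ x))
      (fun x => ENNReal.ofReal (1 / τ) * u ((x - ν) / τ)) := by
  have hμ' : |(μ - ν) / τ| ≤ ρ := by rwa [abs_div, abs_of_pos hτ, div_le_iff₀ hτ]
  have hσ' : |σ / τ - 1| ≤ ρ := by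
    rwa [div_sub_one hτ.ne', abs_div, abs_of_pos hτ, div_le_iff₀ hτ]
  have h := (hu _ _ hμ' hσ').affine ν hτ
  simp only [Set.preimage_univ, ← ENNReal.ofReal_mul (one_div_pos.2 hτ).le,
    ← locScale_eq_rescale φ μ σ ν hτ] at h
  exact h

lemma hasUpperBrackets_locScaleFamily (hφ : TailDominated D β φ) (hD : 0 ≤ D) (hβ : 1 ≤ β)
    (hη : 0 < η) (hρ : 0 < ρ) (hu : IsLocalBracket φ ρ η u) (hA : 0 < A) (hc : 0 < c) :
    HasUpperBrackets volume (Set.Icc (-A) A) (ENNReal.ofReal η)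
      ((⌈2 * (D / (η / (2 * A)) + A) / (ρ * c)⌉₊ + 1) ^ 2 + 1) (locScaleFamily φ c) := by
  classical
  set R := D / (η / (2 * A)) + A
  set s := ρ * c with hs
  have hs0 : 0 < s := by positivity
  refine ⟨insert ((Set.Icc (-A) A).indicator fun _ => ENNReal.ofReal (η / (2 * A)))
    ((Finset.range (⌈2 * R / s⌉₊ + 1) ×ˢ Finset.range (⌈2 * R / s⌉₊ + 1)).image fun p x =>
      ENNReal.ofReal (1 / (p.1 * s)) * u ((x - (p.2 * s - R)) / (p.1 * s))), ?_, ?_⟩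
  · refine (Nat.cast_le.2 ((Finset.card_insert_le _ _).trans
      (Nat.succ_le_succ Finset.card_image_le))).trans_eq ?_
    rw [Finset.card_product, Finset.card_range]
    push_cast
    ring
  · rintro _ ⟨μ, σ, hσc, rfl⟩
    have hσ : 0 < σ := hc.trans_le hσc
    by_cases hfar : R ≤ σ ∨ R ≤ |μ|
    · exact ⟨_, Finset.mem_insert_self _ _,
        isUpperBracket_locScale_of_far hφ hD hβ hη hA hσ hfar⟩
    obtain ⟨hσR, hμR⟩ := not_or.1 hfar
    obtain ⟨hμ1, hμ2⟩ := abs_lt.1 (not_le.1 hμR)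
    obtain ⟨i, hi, hσi, hiσ⟩ := exists_natCast_mul_mem_Icc hs0 hσ.le
      (by linarith : σ ≤ 2 * R)
    obtain ⟨j, hj, hμj, hjμ⟩ := exists_natCast_mul_mem_Icc hs0 (by linarith : 0 ≤ μ + R)
      (by linarith : μ + R ≤ 2 * R)
    have hmesh : s ≤ ρ * (i * s) := by
      rw [hs]
      gcongr
      exact hσc.trans hσi
    refine ⟨_, Finset.mem_insert_of_mem (Finset.mem_image_of_mem _
      (Finset.mk_mem_product hi hj)), (hu.isUpperBracket_locScale (hσ.trans_le hσi) ?_ ?_).mono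
        (Set.subset_univ _) le_rfl⟩
    · exact abs_le.2 ⟨by linarith, by linarith⟩
    · exact abs_le.2 ⟨by linarith, by linarith⟩

lemma exists_hasUpperBrackets_locScaleFamily_exp (hφ : TailDominated D β φ) (hD : 0 ≤ D)
    (hβ : 1 ≤ β) (hη : 0 < η) (hρ : 0 < ρ) (hu : IsLocalBracket φ ρ η u) (hc : 0 < c) :
    ∃ B, ∀ t, 0 ≤ t → HasUpperBrackets volume (Set.Icc (-Real.exp t) (Real.exp t))
      (ENNReal.ofReal η) (B * Real.exp (4 * t)) (locScaleFamily φ (c * Real.exp (-t))) := by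
  set K := 2 * (2 * D / η + 1) / (ρ * c) with hK
  have hK0 : 0 ≤ K := by positivity
  refine ⟨(K + 2) ^ 2 + 1, fun t ht => (hasUpperBrackets_locScaleFamily hφ hD hβ hη hρ hu
    (Real.exp_pos t) (by positivity)).mono le_rfl ?_ subset_rfl⟩
  set E := Real.exp (2 * t) with hE
  have hE1 : 1 ≤ E := Real.one_le_exp (by positivity)
  have hgrid : 2 * (D / (η / (2 * Real.exp t)) + Real.exp t) / (ρ * (c * Real.exp (-t)))
      = K * E := by
    rw [hK, hE, two_mul t, Real.exp_add, Real.exp_neg]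
    field_simp
  rw [hgrid]
  have hceil : (⌈K * E⌉₊ : ℝ) + 1 ≤ (K + 2) * E := by
    linarith [Nat.ceil_lt_add_one (mul_nonneg hK0 (by positivity : 0 ≤ E))]
  calc ((⌈K * E⌉₊ : ℝ) + 1) ^ 2 + 1 ≤ ((K + 2) * E) ^ 2 + E ^ 2 := by
        gcongr
        exact one_le_pow₀ hE1
    _ = ((K + 2) ^ 2 + 1) * Real.exp (4 * t) := by
        have hE2 : Real.exp (4 * t) = E ^ 2 := by
          rw [hE, ← Real.exp_nat_mul]
          ring_nf
        rw [hE2]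
        ring

end LocationScaleBrackets

section SieveBrackets

variable {M : ℕ} {f : Fin M → ℝ → ℝ} {θ : Param M} {c : ℝ}

/-- The mixture densities with parameter in `sieve M c`, as `ℝ≥0∞`-valued functions. -/
def sieveDensities (f : Fin M → ℝ → ℝ) (c : ℝ) : Set (ℝ → ℝ≥0∞) :=
  (fun θ x => ENNReal.ofReal (mixture f θ x)) '' sieve M c

lemma sieveDensities_subset_mixtures (hf : ∀ m, IsDensity (f m)) :
    sieveDensities f c ⊆ mixtures fun m => locScaleFamily (f m) c := by
  rintro _ ⟨θ, ⟨hθ, hscale⟩, rfl⟩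
  exact ⟨θ.weight, ⟨hθ.2.1, hθ.1⟩, _, fun m => ⟨θ.loc m, θ.scale m, hscale m, rfl⟩,
    funext fun x => ofReal_mixture hf hθ x⟩

lemma aemeasurable_of_mem_sieveDensities (hf : ∀ m, IsDensity (f m)) {g : ℝ → ℝ≥0∞}
    (hg : g ∈ sieveDensities f c) : AEMeasurable g := by
  obtain ⟨θ, hθ, rfl⟩ := hg
  exact (IsDensity.mixture hf hθ.1).1.ennreal_ofReal

lemma lintegral_of_mem_sieveDensities (hf : ∀ m, IsDensity (f m)) {g : ℝ → ℝ≥0∞}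
    (hg : g ∈ sieveDensities f c) : ∫⁻ x, g x = 1 := by
  obtain ⟨θ, hθ, rfl⟩ := hg
  exact (IsDensity.mixture hf hθ.1).2.2

lemma exists_hasUpperBrackets_sieveDensities_exp (hf : ∀ m, IsDensity (f m)) (h1 : TailBound f)
    (h2 : LocalSupMeasurable f) (h3 : ContinuousInParam f) (hc : 0 < c) {ε : ℝ} (hε : 0 < ε)
    (hε1 : ε ≤ 1) :
    ∃ B, ∀ t, 0 ≤ t → HasUpperBrackets volume (Set.Icc (-Real.exp t) (Real.exp t))
      (M * (3 * ENNReal.ofReal ε)) (B * Real.exp (4 * M * t))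
      (sieveDensities f (c * Real.exp (-t))) := by
  obtain ⟨D, β, hD, hβ, htail⟩ := h1.exists_tailDominated
  choose ρ u hρ hu using fun m => exists_isLocalBracket hf h1 h2 h3 m hε
  choose B hB using fun m => exists_hasUpperBrackets_locScaleFamily_exp (htail m) hD hβ.le hε
    (hρ m) (hu m) hc
  refine ⟨∏ m, (⌈1 / ε⌉₊ + 1) * B m, fun t ht => ?_⟩
  have hdens (m : Fin M) : ∀ g ∈ locScaleFamily (f m) (c * Real.exp (-t)),
      AEMeasurable g ∧ ∫⁻ x, g x = 1 := by
    rintro _ ⟨μ, σ, hσ, rfl⟩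
    have h := (hf m).locScale μ ((by positivity : 0 < c * Real.exp (-t)).trans_le hσ)
    exact ⟨h.1.ennreal_ofReal, h.2.2⟩
  refine (hasUpperBrackets_mixtures hε hε1 (fun m g hg => (hdens m g hg).1)
    (fun m g hg => (hdens m g hg).2.le) fun m => hB m t ht).mono (by simp) (le_of_eq ?_)
    (sieveDensities_subset_mixtures hf)
  have hexp : Real.exp (4 * M * t) = Real.exp (4 * t) ^ M := by
    rw [← Real.exp_nat_mul]
    ring_nf
  simp only [← mul_assoc, Finset.prod_mul_distrib, Finset.prod_const, Finset.card_univ,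
    Fintype.card_fin, hexp]

lemma hasSubexponentialBrackets_sieveDensities (hf : ∀ m, IsDensity (f m)) (h1 : TailBound f)
    (h2 : LocalSupMeasurable f) (h3 : ContinuousInParam f) (hc : 0 < c) {d : ℝ} (hd : d < 1) :
    HasSubexponentialBrackets volume
      (fun n : ℕ => Set.Icc (-Real.exp ((n : ℝ) ^ d)) (Real.exp ((n : ℝ) ^ d)))
      (fun n : ℕ => sieveDensities f (c * Real.exp (-((n : ℝ) ^ d)))) := by
  intro η hη
  have hε : 0 < min 1 (η / (3 * M + 1)) := by positivity
  obtain ⟨B, hB⟩ := exists_hasUpperBrackets_sieveDensities_exp hf h1 h2 h3 hc hε (min_le_left _ _)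
  refine ⟨fun n => B * Real.exp (4 * M * (n : ℝ) ^ d), fun τ hτ => ?_, fun n =>
    (hB _ (by positivity)).mono ?_ le_rfl subset_rfl⟩
  · refine ((summable_exp_mul_rpow_sub hd (4 * M) hτ).mul_left B).congr fun n => ?_
    simp only [sub_eq_add_neg, Real.exp_add, mul_assoc]
  · calc (M : ℝ≥0∞) * (3 * ENNReal.ofReal (min 1 (η / (3 * M + 1))))
        = ENNReal.ofReal (M * (3 * min 1 (η / (3 * M + 1)))) := by
          rw [ENNReal.ofReal_mul (by positivity), ENNReal.ofReal_mul (by norm_num),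
            ENNReal.ofReal_natCast, ENNReal.ofReal_ofNat]
      _ ≤ ENNReal.ofReal η := by
          refine ENNReal.ofReal_le_ofReal ?_
          calc M * (3 * min 1 (η / (3 * M + 1))) ≤ M * (3 * (η / (3 * M + 1))) := by
                gcongr
                exact min_le_right _ _
            _ ≤ (3 * M + 1) * (η / (3 * M + 1)) := by
                nlinarith [(by positivity : 0 ≤ η / (3 * M + 1))]
            _ = η := mul_div_cancel₀ _ (by positivity)

lemma eventually_mem_sieve (hθ : θ ∈ paramSpace M) (c : ℝ) {d : ℝ} (hd : 0 < d) :
    ∀ᶠ n : ℕ in atTop, θ ∈ sieve M (c * Real.exp (-((n : ℝ) ^ d))) := by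
  have hlim : Tendsto (fun n : ℕ => c * Real.exp (-((n : ℝ) ^ d))) atTop (𝓝 0) := by
    simpa [Real.exp_neg] using (tendsto_exp_natCast_rpow_atTop hd).inv_tendsto_atTop.const_mul c
  filter_upwards [eventually_all.2 fun m => hlim.eventually_le_const (hθ.2.2 m)] with n hn
  exact ⟨hθ, hn⟩

lemma ae_eventually_sample_mem_Icc {Ω : Type*} [MeasurableSpace Ω] {P : Measure Ω}
    {X : ℕ → Ω → ℝ} (h1 : TailBound f) (hθ : θ ∈ paramSpace M) (hX : ∀ i, Measurable (X i))
    (hlaw : ∀ i, P.map (X i) = mixtureMeasure f θ) {d : ℝ} (hd : 0 < d) :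
    ∀ᵐ ω ∂P, ∀ᶠ n : ℕ in atTop, ∀ i < n,
      X i ω ∈ Set.Icc (-Real.exp ((n : ℝ) ^ d)) (Real.exp ((n : ℝ) ^ d)) := by
  obtain ⟨D, β, hD, hβ, htail⟩ := h1.exists_tailDominated
  obtain ⟨I, p, hp, hmass⟩ :=
    (TailDominated.mixture htail hD (by linarith) hθ).exists_withDensity_le
      (envelopeConst_nonneg hD β hθ) hβ
  simpa only [Set.mem_Icc, abs_le] using ae_eventually_forall_abs_le hX hlaw hp hmass hd

lemma ofReal_likelihood (hf : ∀ m, IsDensity (f m)) (hθ : θ ∈ paramSpace M) (x : ℕ → ℝ) (n : ℕ) :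
    ENNReal.ofReal (likelihood f x n θ)
      = ∏ i ∈ Finset.range n, ENNReal.ofReal (mixture f θ (x i)) :=
  ENNReal.ofReal_prod_of_nonneg fun i _ => (IsDensity.mixture hf hθ).2.1 (x i)

lemma IsMLE.prod_ofReal_mixture_le {θ' : Param M} {x : ℕ → ℝ} {n : ℕ}
    (h : IsMLE f (sieve M c) x n θ') (hf : ∀ m, IsDensity (f m)) (hθ : θ ∈ sieve M c) :
    ∏ i ∈ Finset.range n, ENNReal.ofReal (mixture f θ (x i))
      ≤ ∏ i ∈ Finset.range n, ENNReal.ofReal (mixture f θ' (x i)) := by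
  rw [← ofReal_likelihood hf hθ.1, ← ofReal_likelihood hf h.1.1]
  exact ENNReal.ofReal_le_ofReal (h.2 θ hθ)

end SieveBrackets

end LocScaleMixture

end

open LocScaleMixture in
theorem mainTheorem3_general
    {M : ℕ} {f : Fin M → ℝ → ℝ} (hf : ∀ m, IsDensity (f m))
    {θ₀ : Param M} (hθ₀ : θ₀ ∈ paramSpace M) (h1 : TailBound f) (h2 : LocalSupMeasurable f)
    (h3 : ContinuousInParam f) {c₀ d : ℝ} (hc₀ : 0 < c₀) (hd₀ : 0 < d) (hd₁ : d < 1)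
    {Ω : Type*} [MeasurableSpace Ω] {P : Measure Ω} {X : ℕ → Ω → ℝ}
    (hX : ∀ i, Measurable (X i)) (hindep : iIndepFun X P)
    (hlaw : ∀ i, P.map (X i) = mixtureMeasure f θ₀) {θhat : ℕ → Ω → Param M}
    (hMLE : ∀ᵐ ω ∂P, ∀ᶠ n : ℕ in atTop,
      IsMLE f (sieve M (c₀ * Real.exp (-((n : ℝ) ^ d)))) (fun i => X i ω) n (θhat n ω)) :
    ∀ᵐ ω ∂P, Tendsto (fun n : ℕ => eLpNorm (fun x => mixture f (θhat n ω) x - mixture f θ₀ x)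
      1 volume) atTop (𝓝 0) := by
  have hf₀ := IsDensity.mixture hf hθ₀
  have hghat : ∀ᵐ ω ∂P, ∀ᶠ n : ℕ in atTop,
      (fun x => ENNReal.ofReal (mixture f (θhat n ω) x))
          ∈ sieveDensities f (c₀ * Real.exp (-((n : ℝ) ^ d))) ∧
        ∏ i ∈ Finset.range n, ENNReal.ofReal (mixture f θ₀ (X i ω))
          ≤ ∏ i ∈ Finset.range n, ENNReal.ofReal (mixture f (θhat n ω) (X i ω)) := by
    filter_upwards [hMLE] with ω hω
    filter_upwards [hω, eventually_mem_sieve hθ₀ c₀ hd₀] with n hn hmem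
    exact ⟨⟨_, hn.1, rfl⟩, hn.prod_ofReal_mixture_le hf hmem⟩
  have hlim := ae_tendsto_lintegral_sub_of_prod_le hX hindep hlaw hf₀.1.ennreal_ofReal hf₀.2.2
    (ae_eventually_sample_mem_Icc h1 hθ₀ hX hlaw hd₀)
    (fun n g => aemeasurable_of_mem_sieveDensities hf)
    (fun n g => lintegral_of_mem_sieveDensities hf)
    (hasSubexponentialBrackets_sieveDensities hf h1 h2 h3 hc₀ hd₁) hghat
  filter_upwards [hlim, hMLE] with ω hω hmle
  have htwice := ENNReal.Tendsto.const_mul hω (Or.inr ENNReal.ofNat_ne_top) (a := 2)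
  rw [mul_zero] at htwice
  refine htwice.congr' (hmle.mono fun n hn => ?_)
  exact ((IsDensity.mixture hf hn.1.1).eLpNorm_sub_one hf₀).symm

theorem mainTheorem3
    {M : ℕ} (f : Fin M → ℝ → ℝ) (hf : ∀ m, LocScaleMixture.IsDensity (f m))
    (θ₀ : LocScaleMixture.Param M) (hθ₀ : θ₀ ∈ LocScaleMixture.paramSpace M)
    (h1 : LocScaleMixture.TailBound f)
    (h2 : LocScaleMixture.LocalSupMeasurable f)
    (h3 : LocScaleMixture.ContinuousInParam f)
    (h4 : LocScaleMixture.FiniteEntropy f θ₀)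
    (hG : LocScaleMixture.mixture f θ₀ ∈
      LocScaleMixture.subDensitiesCard f M \ LocScaleMixture.subDensitiesCard f (M - 1))
    (c₀ d : ℝ) (hc₀ : 0 < c₀) (hd₀ : 0 < d) (hd₁ : d < 1)
    {Ω : Type*} [MeasurableSpace Ω] (P : Measure Ω) [IsProbabilityMeasure P]
    (X : ℕ → Ω → ℝ) (hX : ∀ i, Measurable (X i)) (hindep : iIndepFun X P)
    (hlaw : ∀ i, P.map (X i) = LocScaleMixture.mixtureMeasure f θ₀)
    (θhat : ℕ → Ω → LocScaleMixture.Param M)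
    (hMLE : ∀ᵐ ω ∂P, ∀ᶠ n : ℕ in atTop,
      LocScaleMixture.IsMLE f (LocScaleMixture.sieve M (c₀ * Real.exp (-((n : ℝ) ^ d))))
        (fun i => X i ω) n (θhat n ω)) :
    ∀ᵐ ω ∂P, Tendsto
      (fun n : ℕ => eLpNorm
        (fun x => LocScaleMixture.mixture f (θhat n ω) x - LocScaleMixture.mixture f θ₀ x)
        1 volume)
      atTop (𝓝 0) :=
  mainTheorem3_general hf hθ₀ h1 h2 h3 hc₀ hd₀ hd₁ hX hindep hlaw hMLE
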